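/- Let $\delta_{GS}>0$ be a real number and let $\eta$ be the Dedekind eta function. For $S\in\mathbb C$ and $T$ in the upper half plane put $$Y(S,T)=S+\bar S+\delta_{GS}\ln\bigl(-i(T-\bar T)\,|\eta(T)|^4\bigr),\qquad \mathcal K=-\ln Y-3\ln\bigl(-i(T-\bar T)\bigr),\qquad W(S,T)=\frac{\Omega(S)\,H(T)}{\eta(T)^6},$$ and let $$V=e^{\mathcal K}\Bigl(\sum_{a,b\in\{S,T\}}\mathcal K^{a\bar b}F_a\bar F_{\bar b}-3|W|^2\Bigr),\qquad F_a=\partial_aW+(\partial_a\mathcal K)\,W,$$ where $\mathcal K^{a\bar b}$ is the inverse of the Kähler metric $\mathcal K_{a\bar b}=\partial_a\partial_{\bar b}\mathcal K$. Here $H$ is a meromorphic function on the upper half plane that is invariant under the modular group up to phases: for every $\gamma\in SL(2,\mathbb Z)$ there is a $\chi(\gamma)\in\mathbb C$ with $|\chi(\gamma)|=1$ and $H(\gamma\cdot T)=\chi(\gamma)H(T)$ for all $T$. Let $T_0=i$ or $T_0=\rho=e^{2\pi i/3}$, let $S_0\in\mathbb C$ be such that $Y(S_0,T_0)>0$, and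 suppose that $\Omega$ is holomorphic near $S_0$ and $H$ is holomorphic near $T_0$. Then $V$ has no de Sitter vacuum at $(S_0,T_0)$; that is, the following three conditions cannot hold simultaneously: (i) $V(S_0,T_0)>0$; (ii) $\partial_SV(S_0,T_0)=0$ and $\partial_TV(S_0,T_0)=0$; (iii) all eigenvalues of the (real $4\times4$) Hessian of $V$ with respect to $\mathrm{Re}\,S,\mathrm{Im}\,S,\mathrm{Re}\,T,\mathrm{Im}\,T$ at $(S_0,T_0)$ are $\ge 0$. Moreover, if (i) and (ii) hold, then $\partial_S\partial_{\bar S}V(S_0,T_0)<0$ in the case $H(T_0)\ne0$, and $\partial_T\partial_{\bar T}V(S_0,T_0)<0$ in the case $H_T(T_0)=\frac{dH}{dT}(T_0)\neq0$. -/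

import Mathlib

open scoped MatrixGroups ComplexConjugate

noncomputable section

namespace Heterotic

/- The two chiral fields are collected in a point `p = (S, T)` of `ℂ × ℂ`; the index `0 : Fin 2`
stands for the dilaton `S`, the index `1` for the Kähler modulus `T`. -/

/-- The displacement of the field number `a` by `z`, the other field being kept fixed. -/
def dir (a : Fin 2) (z : ℂ) : ℂ × ℂ :=
  if a = 0 then (z, 0) else (0, z)

/-- The Wirtinger derivative `∂_a = (∂_x - i ∂_y) / 2` in the field number `a = x + i y`. -/
def dz (a : Fin 2) (f : ℂ × ℂ → ℂ) (p : ℂ × ℂ) : ℂ :=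
  (lineDeriv ℝ f p (dir a 1) - Complex.I * lineDeriv ℝ f p (dir a Complex.I)) / 2

/-- The Wirtinger derivative `∂_ā = (∂_x + i ∂_y) / 2` in the field number `a = x + i y`. -/
def dzbar (a : Fin 2) (f : ℂ × ℂ → ℂ) (p : ℂ × ℂ) : ℂ :=
  (lineDeriv ℝ f p (dir a 1) + Complex.I * lineDeriv ℝ f p (dir a Complex.I)) / 2

/-! ### The F-term scalar potential of `N = 1` supergravity -/

/-- The Kähler metric `K_{a b̄} = ∂_a ∂_b̄ K`. -/
def kahlerMetric (K : ℂ × ℂ → ℝ) (p : ℂ × ℂ) : Matrix (Fin 2) (Fin 2) ℂ :=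
  Matrix.of fun a b => dz a (dzbar b fun q => (K q : ℂ)) p

/-- The inverse Kähler metric `K^{a b̄}`, normalised by `∑_b K^{a b̄} K_{c b̄} = δ^a_c`. -/
def invKahlerMetric (K : ℂ × ℂ → ℝ) (p : ℂ × ℂ) : Matrix (Fin 2) (Fin 2) ℂ :=
  ((kahlerMetric K p)⁻¹).transpose

/-- The F-term `F_a = ∂_a W + (∂_a K) W`. -/
def fTerm (K : ℂ × ℂ → ℝ) (W : ℂ × ℂ → ℂ) (a : Fin 2) (p : ℂ × ℂ) : ℂ :=
  dz a W p + dz a (fun q => (K q : ℂ)) p * W p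

/-- The scalar potential `V = e^K (K^{a b̄} F_a F̄_b̄ - 3 W W̄)`. The double sum is real because the
Kähler metric is Hermitian; taking its real part only makes `V` a real-valued function. -/
def scalarPotential (K : ℂ × ℂ → ℝ) (W : ℂ × ℂ → ℂ) (p : ℂ × ℂ) : ℝ :=
  Real.exp (K p) *
    ((∑ a, ∑ b, invKahlerMetric K p a b * fTerm K W a p * conj (fTerm K W b p)).re
      - 3 * ‖W p‖ ^ 2)

/-! ### Vacua -/

/-- The displacements along the four real coordinates `s, b, x, t`, where `S = s + i b` and
`T = x + i t`. -/
def realDir : Fin 4 → ℂ × ℂ :=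
  ![dir 0 1, dir 0 Complex.I, dir 1 1, dir 1 Complex.I]

/-- The Hessian: the real `4 × 4` matrix of second partial derivatives in `s, b, x, t`. -/
def hessian (V : ℂ × ℂ → ℝ) (p : ℂ × ℂ) : Matrix (Fin 4) (Fin 4) ℝ :=
  Matrix.of fun i j => lineDeriv ℝ (fun q => lineDeriv ℝ V q (realDir j)) p (realDir i)

/-- `∂_S V = 0` and `∂_T V = 0` at `p`. -/
def IsCritical (V : ℂ × ℂ → ℝ) (p : ℂ × ℂ) : Prop :=
  ∀ a : Fin 2, dz a (fun q => (V q : ℂ)) p = 0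

/-- A (possibly only marginally stable) de Sitter vacuum of `V`: positive energy, a critical point,
and no negative eigenvalue of the Hessian. -/
structure IsDeSitterVacuum (V : ℂ × ℂ → ℝ) (p : ℂ × ℂ) : Prop where
  pos : 0 < V p
  critical : IsCritical V p
  eigenvalues_nonneg :
    ∀ μ : ℝ, Module.End.HasEigenvalue (Matrix.toLin' (hessian V p)) μ → 0 ≤ μ

/-! ### The heterotic model with Green–Schwarz mixing -/

/-- `Y = S + S̄ + δ ln (-i (T - T̄) |η(T)|⁴)`; here `S + S̄ = 2 Re S` and `-i (T - T̄) = 2 Im T`. -/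
def gsY (δ : ℝ) (p : ℂ × ℂ) : ℝ :=
  2 * p.1.re + δ * Real.log (2 * p.2.im * ‖ModularForm.eta p.2‖ ^ 4)

/-- The Kähler potential `K = -ln Y - 3 ln (-i (T - T̄))`. -/
def gsKahler (δ : ℝ) (p : ℂ × ℂ) : ℝ :=
  -Real.log (gsY δ p) - 3 * Real.log (2 * p.2.im)

/-- The superpotential `W = Ω(S) H(T) / η(T)⁶`. -/
def superpotential (Ω H : ℂ → ℂ) (p : ℂ × ℂ) : ℂ :=
  Ω p.1 * H p.2 / ModularForm.eta p.2 ^ 6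

/-- The scalar potential of the model. -/
def gsPotential (δ : ℝ) (Ω H : ℂ → ℂ) : ℂ × ℂ → ℝ :=
  scalarPotential (gsKahler δ) (superpotential Ω H)

/-- `H` is meromorphic on the upper half plane and invariant under the modular group up to a
multiplier system of phases. No growth condition is imposed at the cusp. -/
structure IsModularUpToPhase (H : ℂ → ℂ) : Prop where
  meromorphic : MeromorphicOn H {z : ℂ | 0 < z.im}
  exists_multiplier : ∃ χ : SL(2, ℤ) → Circle, ∀ (γ : SL(2, ℤ)) (τ : UpperHalfPlane),
    H ((γ • τ : UpperHalfPlane) : ℂ) = (χ γ : ℂ) * H (τ : ℂ)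

/-- The elliptic point `ρ = e^{2πi/3}`. -/
def rho : ℂ := Complex.exp (2 * Real.pi * Complex.I / 3)

end Heterotic

end

noncomputable section

namespace Heterotic

open Filter Topology

/-! Write `y = 2 Im T` and `L = ∂_T ln(y |η|⁴)`. Completing the square in the F-terms
(`gsPotential_eq`) gives V = Y⁻¹ y⁻³ |η|⁻¹² ( |H|² |YΩ' − Ω|² + y² Y/(3Y + δ) |ΩH' − (3Ω + δΩ') L
H|² − 3 |Ω|² |H|² ). Up to a constant, `L` is the weight-two non-holomorphic completion of `E₂`, so
it vanishes at `i` and `ρ` (`etaDlog_elliptic`). Invariance of `H` up to phases forces `H = 0` or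
`H' = 0` there. Two cases remain.

If `H' = 0`, then along `T = T₀` the potential is a constant times `(|A|² − 3|Ω|²)/Y` with `A = YΩ'
− Ω`. Stationarity in `S` determines `Ω''`, and `∂_S ∂_S̄ V` becomes a positive multiple of `|Ω|² −
|A|²`. This is negative, since `V > 0` means `|A|² > 3|Ω|²` (`dz_dzbar_dilaton_neg`).

If `H = 0`, stationarity in `S` fixes `Ω'` and stationarity in `T` fixes `H''`; inserting both makes
`∂_T ∂_T̄ V` manifestly negative (`dz_dzbar_modulus_neg`).

Since `4 ∂_a ∂_ā V` is the sum of two diagonal entries of the Hessian, a negative value contradicts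
nonnegative eigenvalues (`re_dz_dzbar_nonneg`). Derivatives are computed by a product-and-inverse
calculus for `(∂f, ∂̄f, ∂∂̄f)`; the pure second derivatives never enter and stay existential. -/

/-! ### Wirtinger calculus in one complex variable -/

/-- The real-linear map `h ↦ a h + b h̄`. -/
def wirtingerCLM (a b : ℂ) : ℂ →L[ℝ] ℂ :=
  a • (ContinuousLinearMap.id ℝ ℂ) + b • (Complex.conjCLE : ℂ →L[ℝ] ℂ)

@[simp] lemma wirtingerCLM_apply (a b h : ℂ) : wirtingerCLM a b h = a * h + b * conj h := by
  simp [wirtingerCLM]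

/-- `f` is real differentiable at `z` with `∂f = a` and `∂̄f = b`. -/
def HasWirtingerAt (f : ℂ → ℂ) (a b z : ℂ) : Prop :=
  HasFDerivAt (𝕜 := ℝ) f (wirtingerCLM a b) z

namespace HasWirtingerAt

variable {f g : ℂ → ℂ} {a b a' b' z : ℂ}

lemma of_eq (h : HasWirtingerAt f a b z) (ha : a = a') (hb : b = b') :
    HasWirtingerAt f a' b' z := ha ▸ hb ▸ h

lemma congr (h : HasWirtingerAt f a b z) (hfg : g =ᶠ[𝓝 z] f) : HasWirtingerAt g a b z :=
  HasFDerivAt.congr_of_eventuallyEq h hfg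

protected lemma continuousAt (h : HasWirtingerAt f a b z) : ContinuousAt f z :=
  HasFDerivAt.continuousAt h

protected lemma const (c z : ℂ) : HasWirtingerAt (fun _ => c) 0 0 z := by
  refine (hasFDerivAt_const (𝕜 := ℝ) c z).congr_fderiv ?_
  ext h; simp

lemma of_hasDerivAt (h : HasDerivAt f a z) : HasWirtingerAt f a 0 z := by
  refine (h.hasFDerivAt.restrictScalars ℝ).congr_fderiv ?_
  ext h; simp [mul_comm]

protected lemma id (z : ℂ) : HasWirtingerAt (fun w => w) 1 0 z := of_hasDerivAt (hasDerivAt_id z)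

protected lemma star (h : HasWirtingerAt f a b z) :
    HasWirtingerAt (fun w => conj (f w)) (conj b) (conj a) z := by
  refine ((Complex.conjCLE : ℂ →L[ℝ] ℂ).hasFDerivAt.comp z h).congr_fderiv ?_
  ext h; simp [add_comm]

protected lemma add (hf : HasWirtingerAt f a b z) (hg : HasWirtingerAt g a' b' z) :
    HasWirtingerAt (fun w => f w + g w) (a + a') (b + b') z := by
  refine (HasFDerivAt.fun_add hf hg).congr_fderiv ?_
  ext h; simp; ring

protected lemma mul (hf : HasWirtingerAt f a b z) (hg : HasWirtingerAt g a' b' z) :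
    HasWirtingerAt (fun w => f w * g w) (a * g z + f z * a') (b * g z + f z * b') z := by
  refine (HasFDerivAt.fun_mul hf hg).congr_fderiv ?_
  ext h; simp; ring

lemma comp_hasDerivAt {φ : ℂ → ℂ} {φ' : ℂ} (hφ : HasDerivAt φ φ' (f z))
    (hf : HasWirtingerAt f a b z) :
    HasWirtingerAt (fun w => φ (f w)) (φ' * a) (φ' * b) z := by
  refine ((hφ.hasFDerivAt.restrictScalars ℝ).comp z hf).congr_fderiv ?_
  ext h; simp; ring

protected lemma const_mul (c : ℂ) (hf : HasWirtingerAt f a b z) :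
    HasWirtingerAt (fun w => c * f w) (c * a) (c * b) z :=
  ((HasWirtingerAt.const c z).mul hf).of_eq (by ring) (by ring)

protected lemma neg (hf : HasWirtingerAt f a b z) : HasWirtingerAt (fun w => -f w) (-a) (-b) z := by
  simpa using hf.const_mul (-1)

protected lemma sub (hf : HasWirtingerAt f a b z) (hg : HasWirtingerAt g a' b' z) :
    HasWirtingerAt (fun w => f w - g w) (a - a') (b - b') z := by
  simpa [sub_eq_add_neg] using hf.add hg.neg

protected lemma inv (hf : HasWirtingerAt f a b z) (h0 : f z ≠ 0) :
    HasWirtingerAt (fun w => (f w)⁻¹) (-a / f z ^ 2) (-b / f z ^ 2) z :=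
  (hf.comp_hasDerivAt (hasDerivAt_inv h0)).of_eq (by ring) (by ring)

protected lemma div (hf : HasWirtingerAt f a b z) (hg : HasWirtingerAt g a' b' z) (h0 : g z ≠ 0) :
    HasWirtingerAt (fun w => f w / g w) ((a * g z - f z * a') / g z ^ 2)
      ((b * g z - f z * b') / g z ^ 2) z := by
  simp only [div_eq_mul_inv (f _)]
  refine (hf.mul (hg.inv h0)).of_eq ?_ ?_ <;> field_simp <;> ring

lemma ofReal_log {y : ℂ → ℝ} (hy : HasWirtingerAt (fun w => (y w : ℂ)) a b z) (h0 : 0 < y z) :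
    HasWirtingerAt (fun w => (Real.log (y w) : ℂ)) (a / y z) (b / y z) z := by
  have hs : ((y z : ℝ) : ℂ) ∈ Complex.slitPlane := by simpa using h0
  have hc : ContinuousAt y z := by
    have h := Complex.continuous_re.continuousAt.comp hy.continuousAt
    simpa [Function.comp_def] using h
  refine ((hy.comp_hasDerivAt (Complex.hasDerivAt_log hs)).congr ?_).of_eq
    (by ring) (by ring)
  filter_upwards [hc.eventually (lt_mem_nhds h0)] with w hw
  exact Complex.ofReal_log hw.le

end HasWirtingerAt

/-- Second-order data of `f` at `z`: `∂f = a`, `∂̄f = b` and `∂∂̄f = ∂̄∂f = c` at `z`. -/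
def HasWirtingerJet (f : ℂ → ℂ) (a b c z : ℂ) : Prop :=
  ∃ u v : ℂ → ℂ, (∀ᶠ w in 𝓝 z, HasWirtingerAt f (u w) (v w) w) ∧ u z = a ∧ v z = b ∧
    (∃ d, HasWirtingerAt u d c z) ∧ ∃ e, HasWirtingerAt v c e z

namespace HasWirtingerJet

variable {f g : ℂ → ℂ} {a b c a' b' c' z : ℂ}

lemma of_eq (h : HasWirtingerJet f a b c z) (ha : a = a') (hb : b = b') (hc : c = c') :
    HasWirtingerJet f a' b' c' z := ha ▸ hb ▸ hc ▸ h

lemma congr (h : HasWirtingerJet f a b c z) (hfg : g =ᶠ[𝓝 z] f) : HasWirtingerJet g a b c z := by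
  obtain ⟨u, v, h1, h2⟩ := h
  refine ⟨u, v, ?_, h2⟩
  filter_upwards [h1, hfg.eventuallyEq_nhds] with w hw hw'
  exact hw.congr hw'

lemma hasWirtingerAt (h : HasWirtingerJet f a b c z) : HasWirtingerAt f a b z := by
  obtain ⟨u, v, h1, rfl, rfl, -⟩ := h
  exact h1.self_of_nhds

protected lemma const (k z : ℂ) : HasWirtingerJet (fun _ => k) 0 0 0 z :=
  ⟨fun _ => 0, fun _ => 0, .of_forall fun _ => .const _ _, rfl, rfl, ⟨0, .const _ _⟩,
    ⟨0, .const _ _⟩⟩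

lemma of_analyticAt (h : AnalyticAt ℂ f z) : HasWirtingerJet f (deriv f z) 0 0 z := by
  refine ⟨deriv f, fun _ => 0, ?_, rfl, rfl,
    ⟨_, .of_hasDerivAt h.deriv.differentiableAt.hasDerivAt⟩, ⟨0, .const _ _⟩⟩
  filter_upwards [h.eventually_analyticAt] with w hw
  exact .of_hasDerivAt hw.differentiableAt.hasDerivAt

protected lemma id (z : ℂ) : HasWirtingerJet (fun w => w) 1 0 0 z :=
  (of_analyticAt analyticAt_id).of_eq (by simp) rfl rfl

protected lemma star (h : HasWirtingerJet f a b c z) :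
    HasWirtingerJet (fun w => conj (f w)) (conj b) (conj a) (conj c) z := by
  obtain ⟨u, v, h1, rfl, rfl, ⟨d, hd⟩, ⟨e, he⟩⟩ := h
  exact ⟨fun w => conj (v w), fun w => conj (u w), h1.mono fun w hw => hw.star, rfl, rfl,
    ⟨_, he.star⟩, ⟨_, hd.star⟩⟩

protected lemma add (hf : HasWirtingerJet f a b c z) (hg : HasWirtingerJet g a' b' c' z) :
    HasWirtingerJet (fun w => f w + g w) (a + a') (b + b') (c + c') z := by
  obtain ⟨u, v, h1, rfl, rfl, ⟨d, hd⟩, ⟨e, he⟩⟩ := hf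
  obtain ⟨u', v', h1', rfl, rfl, ⟨d', hd'⟩, ⟨e', he'⟩⟩ := hg
  refine ⟨fun w => u w + u' w, fun w => v w + v' w, ?_, rfl, rfl, ⟨_, hd.add hd'⟩, ⟨_, he.add he'⟩⟩
  filter_upwards [h1, h1'] with w hw hw' using hw.add hw'

protected lemma mul (hf : HasWirtingerJet f a b c z) (hg : HasWirtingerJet g a' b' c' z) :
    HasWirtingerJet (fun w => f w * g w) (a * g z + f z * a') (b * g z + f z * b')
      (c * g z + a * b' + b * a' + f z * c') z := by
  have hfz := hf.hasWirtingerAt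
  have hgz := hg.hasWirtingerAt
  obtain ⟨u, v, h1, rfl, rfl, ⟨d, hd⟩, ⟨e, he⟩⟩ := hf
  obtain ⟨u', v', h1', rfl, rfl, ⟨d', hd'⟩, ⟨e', he'⟩⟩ := hg
  refine ⟨fun w => u w * g w + f w * u' w, fun w => v w * g w + f w * v' w, ?_, rfl, rfl,
    ⟨_, ((hd.mul hgz).add (hfz.mul hd')).of_eq rfl (by ring)⟩,
    ⟨_, ((he.mul hgz).add (hfz.mul he')).of_eq (by ring) rfl⟩⟩
  filter_upwards [h1, h1'] with w hw hw' using hw.mul hw'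

protected lemma const_mul (k : ℂ) (hf : HasWirtingerJet f a b c z) :
    HasWirtingerJet (fun w => k * f w) (k * a) (k * b) (k * c) z :=
  ((HasWirtingerJet.const k z).mul hf).of_eq (by ring) (by ring) (by ring)

protected lemma neg (hf : HasWirtingerJet f a b c z) :
    HasWirtingerJet (fun w => -f w) (-a) (-b) (-c) z := by
  simpa using hf.const_mul (-1)

protected lemma sub (hf : HasWirtingerJet f a b c z) (hg : HasWirtingerJet g a' b' c' z) :
    HasWirtingerJet (fun w => f w - g w) (a - a') (b - b') (c - c') z := by
  simpa [sub_eq_add_neg] using hf.add hg.neg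

protected lemma inv (hf : HasWirtingerJet f a b c z) (h0 : f z ≠ 0) :
    HasWirtingerJet (fun w => (f w)⁻¹) (-a / f z ^ 2) (-b / f z ^ 2)
      (2 * a * b / f z ^ 3 - c / f z ^ 2) z := by
  have hfz := hf.hasWirtingerAt
  obtain ⟨u, v, h1, rfl, rfl, ⟨d, hd⟩, ⟨e, he⟩⟩ := hf
  have hsq : HasWirtingerAt (fun w => f w ^ 2) (2 * f z * u z) (2 * f z * v z) z := by
    simp only [pow_two]
    exact (hfz.mul hfz).of_eq (by ring) (by ring)
  refine ⟨fun w => -u w / f w ^ 2, fun w => -v w / f w ^ 2, ?_, rfl, rfl,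
    ⟨_, (hd.neg.div hsq (pow_ne_zero 2 h0)).of_eq rfl ?_⟩,
    ⟨_, (he.neg.div hsq (pow_ne_zero 2 h0)).of_eq ?_ rfl⟩⟩
  · filter_upwards [h1, hfz.continuousAt.eventually_ne h0] with w hw hw' using hw.inv hw'
  all_goals field_simp; ring

end HasWirtingerJet

/-! ### Wirtinger derivatives in the two fields -/

/-- The field number `a` of a point. -/
def field (a : Fin 2) (p : ℂ × ℂ) : ℂ := if a = 0 then p.1 else p.2

/-- The point `p` with its field number `a` replaced by `z`. -/
def slice (a : Fin 2) (p : ℂ × ℂ) (z : ℂ) : ℂ × ℂ := if a = 0 then (z, p.2) else (p.1, z)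

@[simp] lemma field_zero (p : ℂ × ℂ) : field 0 p = p.1 := rfl
@[simp] lemma field_one (p : ℂ × ℂ) : field 1 p = p.2 := rfl
@[simp] lemma slice_zero (p : ℂ × ℂ) (z : ℂ) : slice 0 p z = (z, p.2) := rfl
@[simp] lemma slice_one (p : ℂ × ℂ) (z : ℂ) : slice 1 p z = (p.1, z) := rfl

@[simp] lemma slice_field (a : Fin 2) (p : ℂ × ℂ) : slice a p (field a p) = p := by
  fin_cases a <;> simp [slice, field]

@[simp] lemma slice_slice (a : Fin 2) (p : ℂ × ℂ) (z w : ℂ) :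
    slice a (slice a p z) w = slice a p w := by
  fin_cases a <;> simp [slice]

@[simp] lemma field_slice (a : Fin 2) (p : ℂ × ℂ) (z : ℂ) : field a (slice a p z) = z := by
  fin_cases a <;> simp [slice, field]

lemma add_smul_dir (a : Fin 2) (p : ℂ × ℂ) (t : ℝ) (v : ℂ) :
    p + t • dir a v = slice a p (field a p + t • v) := by
  fin_cases a <;> ext <;> simp [slice, field, dir]

lemma continuous_slice (a : Fin 2) (p : ℂ × ℂ) : Continuous (slice a p) := by
  fin_cases a
  · show Continuous fun z => (z, p.2)
    fun_prop
  · show Continuous fun z => (p.1, z)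
    fun_prop

lemma eventually_slice {a : Fin 2} {p : ℂ × ℂ} {P : ℂ × ℂ → Prop} (h : ∀ᶠ q in 𝓝 p, P q) :
    ∀ᶠ z in 𝓝 (field a p), P (slice a p z) := by
  have := (continuous_slice a p).tendsto (field a p)
  rw [slice_field] at this
  exact this.eventually h

lemma lineDeriv_dir {f : ℂ × ℂ → ℂ} {a : Fin 2} {p : ℂ × ℂ} {α β : ℂ}
    (h : HasWirtingerAt (fun z => f (slice a p z)) α β (field a p)) (v : ℂ) :
    lineDeriv ℝ f p (dir a v) = α * v + β * conj v := by
  have h2 := (HasFDerivAt.hasLineDerivAt h v).lineDeriv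
  simp only [lineDeriv, add_smul_dir, wirtingerCLM_apply] at h2 ⊢
  exact h2

lemma dz_eq {f : ℂ × ℂ → ℂ} {a : Fin 2} {p : ℂ × ℂ} {α β : ℂ}
    (h : HasWirtingerAt (fun z => f (slice a p z)) α β (field a p)) : dz a f p = α := by
  rw [dz, lineDeriv_dir h, lineDeriv_dir h]
  simp only [map_one, Complex.conj_I]
  linear_combination (-(α - β) / 2) * Complex.I_sq

lemma dzbar_eq {f : ℂ × ℂ → ℂ} {a : Fin 2} {p : ℂ × ℂ} {α β : ℂ}
    (h : HasWirtingerAt (fun z => f (slice a p z)) α β (field a p)) : dzbar a f p = β := by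
  rw [dzbar, lineDeriv_dir h, lineDeriv_dir h]
  simp only [map_one, Complex.conj_I]
  linear_combination ((α - β) / 2) * Complex.I_sq

lemma dz_dzbar_eq {f : ℂ × ℂ → ℂ} {a : Fin 2} {p : ℂ × ℂ} {α β γ : ℂ}
    (h : HasWirtingerJet (fun z => f (slice a p z)) α β γ (field a p)) :
    dz a (dzbar a f) p = γ := by
  obtain ⟨u, v, h1, -, -, -, ⟨e, he⟩⟩ := h
  refine dz_eq (he.congr ?_)
  filter_upwards [h1] with z hz
  refine dzbar_eq (α := u z) ?_
  simpa using hz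

/-! ### The Hessian -/

lemma lineDeriv_lineDeriv_eq {V : ℂ × ℂ → ℝ} {p : ℂ × ℂ} (hV : ContDiffAt ℝ 2 V p) (v w : ℂ × ℂ) :
    lineDeriv ℝ (fun q => lineDeriv ℝ V q v) p w = fderiv ℝ (fderiv ℝ V) p w v := by
  have h1 : (fun q => lineDeriv ℝ V q v) =ᶠ[𝓝 p] fun q => fderiv ℝ V q v := by
    filter_upwards [hV.eventually (by simp)] with q hq
    exact (hq.differentiableAt (by norm_num)).lineDeriv_eq_fderiv
  have h2 : DifferentiableAt ℝ (fderiv ℝ V) p :=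
    (hV.fderiv_right (m := 1) (by norm_num)).differentiableAt (by norm_num)
  rw [h1.lineDeriv_eq,
    (h2.clm_apply (differentiableAt_const v)).lineDeriv_eq_fderiv,
    fderiv_clm_apply h2 (differentiableAt_const v)]
  simp

lemma hessian_isHermitian {V : ℂ × ℂ → ℝ} {p : ℂ × ℂ} (hV : ContDiffAt ℝ 2 V p) :
    (hessian V p).IsHermitian := by
  ext i j
  simp only [Matrix.conjTranspose_apply, hessian, Matrix.of_apply, star_trivial,
    lineDeriv_lineDeriv_eq hV]
  exact (hV.isSymmSndFDerivAt (by simp)).eq _ _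

/-- A symmetric real matrix without negative eigenvalues is positive semidefinite, so its diagonal
is nonnegative. -/
lemma hessian_diag_nonneg {V : ℂ × ℂ → ℝ} {p : ℂ × ℂ} (hV : ContDiffAt ℝ 2 V p)
    (h : ∀ μ : ℝ, Module.End.HasEigenvalue (Matrix.toLin' (hessian V p)) μ → 0 ≤ μ) (i : Fin 4) :
    0 ≤ hessian V p i i := by
  have hH := hessian_isHermitian hV
  have hpos : (hessian V p).PosSemidef := by
    rw [hH.posSemidef_iff_eigenvalues_nonneg]
    intro i
    refine h _ (Module.End.hasEigenvalue_iff_mem_spectrum.2 ?_)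
    rw [Matrix.spectrum_toLin']
    exact hH.eigenvalues_mem_spectrum_real i
  exact hpos.diag_nonneg

lemma lineDeriv_ofReal {V : ℂ × ℂ → ℝ} {p v : ℂ × ℂ} (hV : DifferentiableAt ℝ V p) :
    lineDeriv ℝ (fun q => (V q : ℂ)) p v = lineDeriv ℝ V p v := by
  have h := Complex.ofRealCLM.hasFDerivAt.comp p hV.hasFDerivAt
  have h2 := (h.hasLineDerivAt v).lineDeriv
  rw [hV.lineDeriv_eq_fderiv]
  simpa [Function.comp_def] using h2

/-- `∂∂̄` is a quarter of the Laplacian in one field. The mixed partials contribute only to the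
imaginary part, so two diagonal Hessian entries decide the sign. -/
lemma re_dz_dzbar_nonneg {V : ℂ × ℂ → ℝ} {p : ℂ × ℂ} (hV : ContDiffAt ℝ 2 V p)
    (h : ∀ μ : ℝ, Module.End.HasEigenvalue (Matrix.toLin' (hessian V p)) μ → 0 ≤ μ) (a : Fin 2) :
    0 ≤ (dz a (dzbar a fun q => (V q : ℂ)) p).re := by
  set D : ℂ → ℂ × ℂ → ℝ := fun v q => lineDeriv ℝ V q (dir a v) with hD
  have hd : ∀ v, DifferentiableAt ℝ (D v) p := by
    intro v
    have h1 : D v =ᶠ[𝓝 p] fun q => fderiv ℝ V q (dir a v) := by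
      filter_upwards [hV.eventually (by simp)] with q hq
      exact (hq.differentiableAt (by norm_num)).lineDeriv_eq_fderiv
    exact (((hV.fderiv_right (m := 1) (by norm_num)).differentiableAt (by norm_num)).clm_apply
      (differentiableAt_const _)).congr_of_eventuallyEq h1
  have hev : (dzbar a fun q => (V q : ℂ)) =ᶠ[𝓝 p]
      fun q => (((1 / 2 : ℝ) * D 1 q : ℝ) : ℂ) + Complex.I * (((1 / 2 : ℝ) * D Complex.I q : ℝ) : ℂ) := by
    filter_upwards [hV.eventually (by simp)] with q hq
    have hq' := hq.differentiableAt (by norm_num)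
    simp only [dzbar, lineDeriv_ofReal hq', hD]
    push_cast
    ring
  have hline : ∀ w, lineDeriv ℝ (dzbar a fun q => (V q : ℂ)) p (dir a w) =
      (((1 / 2 : ℝ) * lineDeriv ℝ (D 1) p (dir a w) : ℝ) : ℂ) +
      Complex.I * (((1 / 2 : ℝ) * lineDeriv ℝ (D Complex.I) p (dir a w) : ℝ) : ℂ) := by
    intro w
    rw [hev.lineDeriv_eq]
    have hh : ∀ v, HasLineDerivAt ℝ (fun q => (((1 / 2 : ℝ) * D v q : ℝ) : ℂ))
        (((1 / 2 : ℝ) * lineDeriv ℝ (D v) p (dir a w) : ℝ) : ℂ) p (dir a w) := by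
      intro v
      have h1 := Complex.ofRealCLM.hasFDerivAt.comp p ((hd v).const_mul (1 / 2 : ℝ)).hasFDerivAt
      have h2 := h1.hasLineDerivAt (dir a w)
      rw [(hd v).lineDeriv_eq_fderiv]
      simpa [Function.comp_def, fderiv_const_mul (hd v)] using h2
    exact HasLineDerivAt.lineDeriv (HasDerivAt.add (hh 1)
      (HasDerivAt.const_mul Complex.I (hh Complex.I)))
  rw [dz, hline, hline]
  have hii : 0 ≤ lineDeriv ℝ (D 1) p (dir a 1) := by
    fin_cases a
    · exact hessian_diag_nonneg hV h 0
    · exact hessian_diag_nonneg hV h 2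
  have hjj : 0 ≤ lineDeriv ℝ (D Complex.I) p (dir a Complex.I) := by
    fin_cases a
    · exact hessian_diag_nonneg hV h 1
    · exact hessian_diag_nonneg hV h 3
  simp only [Complex.add_re, Complex.sub_re, Complex.mul_re, Complex.ofReal_re, Complex.ofReal_im,
    Complex.I_re, Complex.I_im, Complex.div_ofNat_re, Complex.add_im, Complex.mul_im]
  linarith

/-! ### The potential in closed form -/

/-- `∂_T ln (-i (T - T̄) |η(T)|⁴)`. -/
def etaDlog (T : ℂ) : ℂ := 1 / (T - conj T) + 2 * logDeriv ModularForm.eta T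

/-- The function `-i (T - T̄) = 2 Im T`. -/
def imTwo (T : ℂ) : ℂ := -Complex.I * (T - conj T)

lemma imTwo_eq (T : ℂ) : imTwo T = ((2 * T.im : ℝ) : ℂ) := by
  rw [imTwo, Complex.sub_conj]
  push_cast
  linear_combination (-2 * (T.im : ℂ)) * Complex.I_sq

lemma sub_conj_ne_zero {T : ℂ} (hT : 0 < T.im) : T - conj T ≠ 0 := by
  rw [Complex.sub_conj]
  simp [hT.ne']

lemma imTwo_ne_zero {T : ℂ} (hT : 0 < T.im) : imTwo T ≠ 0 :=
  mul_ne_zero (neg_ne_zero.2 Complex.I_ne_zero) (sub_conj_ne_zero hT)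

lemma eta_ne_zero {T : ℂ} (hT : 0 < T.im) : ModularForm.eta T ≠ 0 :=
  ModularForm.eta_ne_zero hT

lemma analyticAt_eta {T : ℂ} (hT : 0 < T.im) : AnalyticAt ℂ ModularForm.eta T := by
  rw [Complex.analyticAt_iff_eventually_differentiableAt]
  filter_upwards [UpperHalfPlane.isOpen_upperHalfPlaneSet.mem_nhds hT] with z hz
  exact ModularForm.differentiableAt_eta_of_mem_upperHalfPlaneSet hz

lemma analyticAt_logDeriv_eta {T : ℂ} (hT : 0 < T.im) :
    AnalyticAt ℂ (logDeriv ModularForm.eta) T :=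
  (analyticAt_eta hT).deriv.div (analyticAt_eta hT) (eta_ne_zero hT)

lemma HasWirtingerAt.sub_conj (z : ℂ) : HasWirtingerAt (fun w => w - conj w) 1 (-1) z := by
  simpa using (HasWirtingerAt.id z).sub (HasWirtingerAt.id z).star

lemma hasWirtingerAt_imTwo (z : ℂ) : HasWirtingerAt imTwo (-Complex.I) Complex.I z :=
  ((HasWirtingerAt.sub_conj z).const_mul (-Complex.I)).of_eq (by ring) (by ring)

lemma hasWirtingerAt_log_im {T : ℂ} (hT : 0 < T.im) :
    HasWirtingerAt (fun w => ((Real.log (2 * w.im) : ℝ) : ℂ)) (1 / (T - conj T))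
      (1 / (conj T - T)) T := by
  have h := (hasWirtingerAt_imTwo T).congr (g := fun w => ((2 * w.im : ℝ) : ℂ))
    (.of_forall fun w => (imTwo_eq w).symm)
  have h0 := sub_conj_ne_zero hT
  have h0' : conj T - T ≠ 0 := by rw [← neg_sub]; exact neg_ne_zero.2 h0
  refine (h.ofReal_log (by positivity)).of_eq ?_ ?_ <;> rw [← imTwo_eq, imTwo]
  · field_simp
  · have := Complex.I_ne_zero
    field_simp
    ring

lemma hasWirtingerAt_log_eta {T : ℂ} (hT : 0 < T.im) :
    HasWirtingerAt (fun w => ((Real.log (2 * w.im * ‖ModularForm.eta w‖ ^ 4) : ℝ) : ℂ))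
      (etaDlog T) (conj (etaDlog T)) T := by
  have hη := HasWirtingerAt.of_hasDerivAt (analyticAt_eta hT).differentiableAt.hasDerivAt
  have hη0 := eta_ne_zero hT
  have hn : HasWirtingerAt (fun w => ((‖ModularForm.eta w‖ ^ 4 : ℝ) : ℂ))
      (2 * logDeriv ModularForm.eta T * (‖ModularForm.eta T‖ ^ 4 : ℝ))
      (2 * conj (logDeriv ModularForm.eta T) * (‖ModularForm.eta T‖ ^ 4 : ℝ)) T := by
    -- `|η|⁴ = (η η̄)²` is a product of holomorphic and antiholomorphic factors, to which the
    -- product rule applies.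
    have key : ∀ w, ((‖ModularForm.eta w‖ ^ 4 : ℝ) : ℂ) =
        (ModularForm.eta w * conj (ModularForm.eta w)) *
        (ModularForm.eta w * conj (ModularForm.eta w)) := by
      intro w
      rw [Complex.mul_conj']
      push_cast
      ring
    refine (((hη.mul hη.star).mul (hη.mul hη.star)).congr (.of_forall key)).of_eq ?_ ?_ <;>
    · rw [key, logDeriv_apply]
      simp only [map_div₀, map_zero]
      have : conj (ModularForm.eta T) ≠ 0 := by simpa using hη0
      field_simp
      ring
  have hi := (hasWirtingerAt_imTwo T).congr (g := fun w => ((2 * w.im : ℝ) : ℂ))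
    (.of_forall fun w => (imTwo_eq w).symm)
  have hm := (hi.mul hn).congr
    (g := fun w => ((2 * w.im * ‖ModularForm.eta w‖ ^ 4 : ℝ) : ℂ))
    (.of_forall fun w => Complex.ofReal_mul _ _)
  have h0 := sub_conj_ne_zero hT
  have h0' : conj T - T ≠ 0 := by rw [← neg_sub]; exact neg_ne_zero.2 h0
  have hn0 : ((‖ModularForm.eta T‖ ^ 4 : ℝ) : ℂ) ≠ 0 := by
    exact_mod_cast pow_ne_zero 4 (norm_ne_zero_iff.2 hη0)
  have hI := Complex.I_ne_zero
  refine (hm.ofReal_log (by positivity)).of_eq ?_ ?_ <;>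
    rw [Complex.ofReal_mul (2 * T.im), ← imTwo_eq, etaDlog, imTwo]
  · field_simp
    ring
  · simp only [map_add, map_div₀, map_sub, map_one, Complex.conj_conj, map_mul, map_ofNat]
    field_simp
    ring

/-! ### Derivatives of `Y` and of the Kähler potential; the Kähler metric. -/

variable {δ : ℝ} {p : ℂ × ℂ}

lemma hasWirtingerAt_gsY_zero (δ : ℝ) (p : ℂ × ℂ) (z : ℂ) :
    HasWirtingerAt (fun w => (gsY δ (slice 0 p w) : ℂ)) 1 1 z := by
  have h := (((HasWirtingerAt.id z).add (HasWirtingerAt.id z).star).add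
    (HasWirtingerAt.const
      ((δ * Real.log (2 * p.2.im * ‖ModularForm.eta p.2‖ ^ 4) : ℝ) : ℂ) z))
  refine (h.congr (.of_forall fun w => ?_)).of_eq (by simp) (by simp)
  simp only [gsY, slice_zero, Complex.ofReal_add, Complex.add_conj]

lemma hasWirtingerAt_gsY_one (δ : ℝ) (p : ℂ × ℂ) {z : ℂ} (hz : 0 < z.im) :
    HasWirtingerAt (fun w => (gsY δ (slice 1 p w) : ℂ)) (δ * etaDlog z) (δ * conj (etaDlog z)) z := by
  have h := (HasWirtingerAt.const ((2 * p.1.re : ℝ) : ℂ) z).add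
    ((hasWirtingerAt_log_eta hz).const_mul (δ : ℂ))
  refine (h.congr (.of_forall fun w => ?_)).of_eq (by simp) (by simp)
  simp only [gsY, slice_one, Complex.ofReal_add, Complex.ofReal_mul]

lemma hasWirtingerAt_gsY (δ : ℝ) {p : ℂ × ℂ} (hp : 0 < p.2.im) (a : Fin 2) :
    HasWirtingerAt (fun w => (gsY δ (slice a p w) : ℂ)) (![1, δ * etaDlog p.2] a)
      (![1, δ * conj (etaDlog p.2)] a) (field a p) := by
  fin_cases a
  · exact hasWirtingerAt_gsY_zero δ p _
  · exact hasWirtingerAt_gsY_one δ p hp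

/-- The domain on which the model is defined. -/
def modelDomain (δ : ℝ) : Set (ℂ × ℂ) := {p | 0 < p.2.im ∧ 0 < gsY δ p}

lemma contDiffAt_gsY (δ : ℝ) {p : ℂ × ℂ} (hp : 0 < p.2.im) : ContDiffAt ℝ 2 (gsY δ) p := by
  have hη : ContDiffAt ℝ 2 (fun q : ℂ × ℂ => ModularForm.eta q.2) p :=
    ((analyticAt_eta hp).contDiffAt.restrict_scalars ℝ).comp p contDiffAt_snd
  have hη0 := eta_ne_zero hp
  have him : ContDiffAt ℝ 2 (fun q : ℂ × ℂ => q.2.im) p :=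
    Complex.imCLM.contDiff.contDiffAt.comp p contDiffAt_snd
  have hre : ContDiffAt ℝ 2 (fun q : ℂ × ℂ => q.1.re) p :=
    Complex.reCLM.contDiff.contDiffAt.comp p contDiffAt_fst
  refine (contDiffAt_const.mul hre).add (contDiffAt_const.mul (ContDiffAt.log
    ((contDiffAt_const.mul him).mul ((hη.norm ℝ hη0).pow 4)) ?_))
  have := norm_pos_iff.2 hη0
  positivity

lemma modelDomain_mem_nhds (hp : p ∈ modelDomain δ) : modelDomain δ ∈ 𝓝 p := by
  have h1 : ∀ᶠ q : ℂ × ℂ in 𝓝 p, 0 < q.2.im :=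
    (Complex.continuous_im.comp continuous_snd).continuousAt.eventually (lt_mem_nhds hp.1)
  exact h1.and ((contDiffAt_gsY δ hp.1).continuousAt.eventually (lt_mem_nhds hp.2))

lemma hasWirtingerAt_gsKahler (hp : p ∈ modelDomain δ) (a : Fin 2) :
    HasWirtingerAt (fun w => (gsKahler δ (slice a p w) : ℂ))
      (![-1 / (gsY δ p : ℂ), -(δ * etaDlog p.2) / gsY δ p - 3 / (p.2 - conj p.2)] a)
      (![-1 / (gsY δ p : ℂ), -(δ * conj (etaDlog p.2)) / gsY δ p - 3 / (conj p.2 - p.2)] a)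
      (field a p) := by
  have hY := (hasWirtingerAt_gsY δ hp.1 a).ofReal_log (by simpa using hp.2)
  simp only [slice_field] at hY
  fin_cases a
  · refine (hY.neg.sub (HasWirtingerAt.const ((3 * Real.log (2 * p.2.im) : ℝ) : ℂ) _)).congr
      (.of_forall fun w => ?_) |>.of_eq ?_ ?_
    · simp [gsKahler]
    all_goals simp
    all_goals ring
  · refine (hY.neg.sub ((hasWirtingerAt_log_im hp.1).const_mul 3)).congr
      (.of_forall fun w => ?_) |>.of_eq ?_ ?_
    · simp [gsKahler]
    all_goals simp
    all_goals ring

lemma dz_gsKahler (hp : p ∈ modelDomain δ) (a : Fin 2) :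
    dz a (fun q => (gsKahler δ q : ℂ)) p =
      ![-1 / (gsY δ p : ℂ), -(δ * etaDlog p.2) / gsY δ p - 3 / (p.2 - conj p.2)] a :=
  dz_eq (hasWirtingerAt_gsKahler hp a)

lemma dzbar_gsKahler (hp : p ∈ modelDomain δ) (a : Fin 2) :
    dzbar a (fun q => (gsKahler δ q : ℂ)) p =
      ![-1 / (gsY δ p : ℂ), -(δ * conj (etaDlog p.2)) / gsY δ p - 3 / (conj p.2 - p.2)] a :=
  dzbar_eq (hasWirtingerAt_gsKahler hp a)

/-- The logarithmic derivative of `η` is holomorphic, so its conjugate has no `∂_T`; only `1/(T̄ −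
T)` contributes. The `∂̄` derivative would involve `η''` and is not needed. -/
lemma hasWirtingerAt_conj_etaDlog {T : ℂ} (hT : 0 < T.im) :
    ∃ β, HasWirtingerAt (fun w => conj (etaDlog w)) (1 / (T - conj T) ^ 2) β T := by
  have h0 := sub_conj_ne_zero hT
  have h0' : conj T - T ≠ 0 := by rw [← neg_sub]; exact neg_ne_zero.2 h0
  have h1 := ((HasWirtingerAt.sub_conj T).inv h0)
  have h2 := HasWirtingerAt.of_hasDerivAt
    (analyticAt_logDeriv_eta hT).differentiableAt.hasDerivAt
  have h3 := (h1.add (h2.const_mul 2)).star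
  refine ⟨_, (h3.congr (.of_forall fun w => ?_)).of_eq ?_ rfl⟩
  · simp only [etaDlog, one_div]
  · simp
    field_simp
    ring

/-- `−ln Y` contributes the rank-one matrix `∂Y ∂̄Y / Y²` minus `∂∂̄Y / Y`. The latter, like `−3
ln(2 Im T)`, only affects the `T T̄` entry. -/
lemma kahlerMetric_gsKahler (hp : p ∈ modelDomain δ) :
    kahlerMetric (gsKahler δ) p =
      !![1 / (gsY δ p : ℂ) ^ 2, δ * conj (etaDlog p.2) / (gsY δ p : ℂ) ^ 2;
        δ * etaDlog p.2 / (gsY δ p : ℂ) ^ 2,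
        δ ^ 2 * etaDlog p.2 * conj (etaDlog p.2) / (gsY δ p : ℂ) ^ 2
          - (δ / gsY δ p + 3) / (p.2 - conj p.2) ^ 2] := by
  have hY0 : (gsY δ p : ℂ) ≠ 0 := by exact_mod_cast hp.2.ne'
  have h0 := sub_conj_ne_zero hp.1
  have h0' : conj p.2 - p.2 ≠ 0 := by rw [← neg_sub]; exact neg_ne_zero.2 h0
  have hY : ∀ a, gsY δ (slice a p (field a p)) ≠ 0 := by simpa using hp.2.ne'
  have hev : ∀ a, ∀ᶠ w in 𝓝 (field a p), slice a p w ∈ modelDomain δ :=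
    fun a => eventually_slice (modelDomain_mem_nhds hp)
  have hYi : ∀ a, HasWirtingerAt (fun w => ((gsY δ (slice a p w) : ℂ))⁻¹) _ _ (field a p) :=
    fun a => (hasWirtingerAt_gsY δ hp.1 a).inv (by exact_mod_cast hY a)
  have e0 : ∀ a, dz a (dzbar 0 fun q => (gsKahler δ q : ℂ)) p =
      ![1, δ * etaDlog p.2] a / (gsY δ p : ℂ) ^ 2 := by
    intro a
    refine dz_eq (((hYi a).neg.congr ?_).of_eq ?_ rfl)
    · filter_upwards [hev a] with w hw
      rw [dzbar_gsKahler hw]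
      simp [neg_div]
    · simp [neg_div]
  have e1 : dz 0 (dzbar 1 fun q => (gsKahler δ q : ℂ)) p =
      δ * conj (etaDlog p.2) / (gsY δ p : ℂ) ^ 2 := by
    refine dz_eq ((((hYi 0).const_mul (-(δ * conj (etaDlog p.2)))).sub
      (HasWirtingerAt.const (3 / (conj p.2 - p.2)) _)).congr ?_ |>.of_eq ?_ rfl)
    · filter_upwards [hev 0] with w hw
      rw [dzbar_gsKahler hw]
      simp [div_eq_mul_inv]
    · simp
      field_simp
  have e2 : dz 1 (dzbar 1 fun q => (gsKahler δ q : ℂ)) p =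
      δ ^ 2 * etaDlog p.2 * conj (etaDlog p.2) / (gsY δ p : ℂ) ^ 2
          - (δ / gsY δ p + 3) / (p.2 - conj p.2) ^ 2 := by
    obtain ⟨β, hβ⟩ := hasWirtingerAt_conj_etaDlog hp.1
    have h3 := ((HasWirtingerAt.sub_conj p.2).inv h0).const_mul (-3)
    refine dz_eq ((((hβ.const_mul (-(δ : ℂ))).mul (hYi 1)).sub h3).congr ?_ |>.of_eq ?_ rfl)
    · filter_upwards [hev 1] with w hw
      rw [dzbar_gsKahler hw]
      have h5 : conj w - w ≠ 0 := by
        rw [← neg_sub]; exact neg_ne_zero.2 (sub_conj_ne_zero hw.1)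
      have h6 : w - conj w ≠ 0 := sub_conj_ne_zero hw.1
      have h7 : (gsY δ (p.1, w) : ℂ) ≠ 0 := by exact_mod_cast hw.2.ne'
      simp
      rw [← neg_sub w (conj w)]
      field_simp
      ring
    · simp
      field_simp
      ring
  ext i j
  fin_cases i <;> fin_cases j
  · simpa [kahlerMetric] using e0 0
  · simpa [kahlerMetric] using e1
  · simpa [kahlerMetric] using e0 1
  · simpa [kahlerMetric] using e2

/-! ### The superpotential, the F-terms and the completed square. -/

variable {Ω H : ℂ → ℂ}

lemma dz_superpotential_zero (hΩ : DifferentiableAt ℂ Ω p.1) :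
    dz 0 (superpotential Ω H) p = deriv Ω p.1 * H p.2 / ModularForm.eta p.2 ^ 6 := by
  have h := (HasWirtingerAt.of_hasDerivAt hΩ.hasDerivAt).const_mul
    (H p.2 / ModularForm.eta p.2 ^ 6)
  refine dz_eq ((h.congr (.of_forall fun w => ?_)).of_eq ?_ rfl)
  · simp only [superpotential, slice_zero]
    ring
  · ring

lemma dz_superpotential_one (hp : 0 < p.2.im) (hH : DifferentiableAt ℂ H p.2) :
    dz 1 (superpotential Ω H) p = Ω p.1 * (deriv H p.2 - 6 * logDeriv ModularForm.eta p.2 * H p.2)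
      / ModularForm.eta p.2 ^ 6 := by
  have hη0 := eta_ne_zero hp
  have h := ((hH.hasDerivAt.const_mul (Ω p.1)).div
    ((analyticAt_eta hp).differentiableAt.hasDerivAt.pow 6) (pow_ne_zero 6 hη0))
  refine dz_eq (((HasWirtingerAt.of_hasDerivAt h).congr (.of_forall fun w => ?_)).of_eq ?_ rfl)
  · simp [superpotential, slice_one]
  · rw [logDeriv_apply]
    simp
    field_simp

/-- The closed form of the scalar potential of the model. -/
def potentialFormula (δ : ℝ) (Ω H : ℂ → ℂ) (p : ℂ × ℂ) : ℂ :=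
  (gsY δ p : ℂ)⁻¹ * (imTwo p.2 * imTwo p.2 * imTwo p.2)⁻¹
    * ((ModularForm.eta p.2 ^ 6)⁻¹ * conj (ModularForm.eta p.2 ^ 6)⁻¹) *
  ((H p.2 * conj (H p.2)) * ((gsY δ p * deriv Ω p.1 - Ω p.1) *
      conj (gsY δ p * deriv Ω p.1 - Ω p.1))
    + imTwo p.2 * imTwo p.2 * (gsY δ p * (3 * gsY δ p + δ : ℂ)⁻¹) *
      ((Ω p.1 * deriv H p.2 - (3 * Ω p.1 + δ * deriv Ω p.1) * (etaDlog p.2 * H p.2)) *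
        conj (Ω p.1 * deriv H p.2 - (3 * Ω p.1 + δ * deriv Ω p.1) * (etaDlog p.2 * H p.2)))
    - 3 * (Ω p.1 * conj (Ω p.1)) * (H p.2 * conj (H p.2)))

lemma exp_gsKahler (hp : p ∈ modelDomain δ) :
    ((Real.exp (gsKahler δ p) : ℝ) : ℂ) =
      (gsY δ p : ℂ)⁻¹ * (imTwo p.2 * imTwo p.2 * imTwo p.2)⁻¹ := by
  have h : Real.exp (gsKahler δ p) = (gsY δ p)⁻¹ * ((2 * p.2.im) * (2 * p.2.im) * (2 * p.2.im))⁻¹ := by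
    have h1 := hp.1
    rw [gsKahler, sub_eq_add_neg, Real.exp_add, Real.exp_neg, Real.exp_log hp.2, Real.exp_neg,
      show 3 * Real.log (2 * p.2.im) = Real.log (2 * p.2.im) + Real.log (2 * p.2.im)
        + Real.log (2 * p.2.im) by ring, Real.exp_add, Real.exp_add, Real.exp_log (by positivity)]
  rw [h, imTwo_eq]
  push_cast
  ring

lemma invKahlerMetric_gsKahler (hδ : 0 < δ) (hp : p ∈ modelDomain δ) :
    invKahlerMetric (gsKahler δ) p =
      !![(gsY δ p : ℂ) ^ 2 + δ ^ 2 * etaDlog p.2 * conj (etaDlog p.2) * (imTwo p.2 ^ 2 * gsY δ p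
            / (3 * gsY δ p + δ)),
          -(δ * etaDlog p.2) * (imTwo p.2 ^ 2 * gsY δ p / (3 * gsY δ p + δ));
        -(δ * conj (etaDlog p.2)) * (imTwo p.2 ^ 2 * gsY δ p / (3 * gsY δ p + δ)),
          imTwo p.2 ^ 2 * gsY δ p / (3 * gsY δ p + δ)] := by
  have hY0 : (gsY δ p : ℂ) ≠ 0 := by exact_mod_cast hp.2.ne'
  have hQ0 : (3 * gsY δ p + δ : ℂ) ≠ 0 := by
    have := hp.2
    exact_mod_cast (by positivity : (3 * gsY δ p + δ : ℝ) ≠ 0)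
  have h0 := sub_conj_ne_zero hp.1
  have hi : imTwo p.2 ^ 2 = -(p.2 - conj p.2) ^ 2 := by
    rw [imTwo, mul_pow, neg_sq, Complex.I_sq]
    ring
  rw [invKahlerMetric, kahlerMetric_gsKahler hp, hi]
  apply Matrix.transpose_injective
  rw [Matrix.transpose_transpose]
  refine Matrix.inv_eq_right_inv ?_
  generalize p.2 - conj p.2 = x at *
  generalize (gsY δ p : ℂ) = Y at *
  generalize etaDlog p.2 = L at *
  generalize (δ : ℂ) = d at *
  -- Eliminating `δ` in favour of `Q = 3Y + δ` turns the denominators into monomials.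
  generalize hQ : 3 * Y + d = Q at *
  obtain rfl : d = Q - 3 * Y := by rw [← hQ]; ring
  ext i j
  fin_cases i <;> fin_cases j <;> simp [Matrix.mul_apply, Fin.sum_univ_two] <;>
    field_simp <;> ring

lemma fTerm_zero (hp : p ∈ modelDomain δ) (hΩ : DifferentiableAt ℂ Ω p.1) :
    fTerm (gsKahler δ) (superpotential Ω H) 0 p =
      (gsY δ p * deriv Ω p.1 - Ω p.1) * H p.2 * (ModularForm.eta p.2 ^ 6)⁻¹ / gsY δ p := by
  have hY0 : (gsY δ p : ℂ) ≠ 0 := by exact_mod_cast hp.2.ne'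
  rw [fTerm, dz_superpotential_zero hΩ, dz_gsKahler hp, superpotential]
  simp
  field_simp
  ring

/-- The combination `F_T − δ L F_S` removes the rank-one part of the metric: in terms of it and
`F_S` the inverse metric is diagonal. -/
lemma fTerm_one (hp : p ∈ modelDomain δ) (hΩ : DifferentiableAt ℂ Ω p.1)
    (hH : DifferentiableAt ℂ H p.2) :
    fTerm (gsKahler δ) (superpotential Ω H) 1 p =
      (Ω p.1 * deriv H p.2 - (3 * Ω p.1 + δ * deriv Ω p.1) * (etaDlog p.2 * H p.2))
        * (ModularForm.eta p.2 ^ 6)⁻¹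
      + δ * etaDlog p.2 * fTerm (gsKahler δ) (superpotential Ω H) 0 p := by
  have hY0 : (gsY δ p : ℂ) ≠ 0 := by exact_mod_cast hp.2.ne'
  have hL : logDeriv ModularForm.eta p.2 = (etaDlog p.2 - 1 / (p.2 - conj p.2)) / 2 := by
    rw [etaDlog]; ring
  have h0 := sub_conj_ne_zero hp.1
  rw [fTerm_zero hp hΩ, fTerm, dz_superpotential_one hp.1 hH, dz_gsKahler hp, superpotential, hL]
  simp
  field_simp
  ring

lemma gsPotential_eq (hδ : 0 < δ) (hp : p ∈ modelDomain δ) (hΩ : DifferentiableAt ℂ Ω p.1)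
    (hH : DifferentiableAt ℂ H p.2) :
    (gsPotential δ Ω H p : ℂ) = potentialFormula δ Ω H p := by
  have hY0 : (gsY δ p : ℂ) ≠ 0 := by exact_mod_cast hp.2.ne'
  have hQ0 : (3 * gsY δ p + δ : ℂ) ≠ 0 := by
    have := hp.2
    exact_mod_cast (by positivity : (3 * gsY δ p + δ : ℝ) ≠ 0)
  set F := fTerm (gsKahler δ) (superpotential Ω H)
  set B := Ω p.1 * deriv H p.2 - (3 * Ω p.1 + δ * deriv Ω p.1) * (etaDlog p.2 * H p.2) with hB
  set A := gsY δ p * deriv Ω p.1 - Ω p.1 with hA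
  set k := (ModularForm.eta p.2 ^ 6)⁻¹ with hk
  have hF0 : F 0 p = A * H p.2 * k / gsY δ p := fTerm_zero hp hΩ
  have hF1 : F 1 p = B * k + δ * etaDlog p.2 * F 0 p := fTerm_one hp hΩ hH
  have hsum : ∑ a, ∑ b, invKahlerMetric (gsKahler δ) p a b * F a p * conj (F b p) =
      (((gsY δ p) ^ 2 * Complex.normSq (F 0 p) + (2 * p.2.im) ^ 2 * gsY δ p / (3 * gsY δ p + δ) *
        Complex.normSq (B * k) : ℝ) : ℂ) := by
    push_cast
    rw [← Complex.mul_conj, ← Complex.mul_conj]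
    have hi := imTwo_eq p.2
    push_cast at hi
    simp only [invKahlerMetric_gsKahler hδ hp, Fin.sum_univ_two, hF1, ← hi]
    simp
    ring
  rw [gsPotential, scalarPotential, hsum, Complex.ofReal_re]
  push_cast
  have hW : ((‖superpotential Ω H p‖ : ℝ) : ℂ) ^ 2 =
      (Ω p.1 * H p.2 * k) * conj (Ω p.1 * H p.2 * k) := by
    rw [← Complex.mul_conj', superpotential, div_eq_mul_inv]
  have hi := imTwo_eq p.2
  push_cast at hi
  have he := exp_gsKahler hp
  push_cast at he
  rw [hW, he, ← Complex.mul_conj, ← Complex.mul_conj, hF0, ← hi, potentialFormula]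
  simp only [← hA, ← hB, ← hk, map_mul, map_div₀, Complex.conj_ofReal]
  field_simp

lemma gsPotential_eventuallyEq (hδ : 0 < δ) (hp : p ∈ modelDomain δ) (hΩ : AnalyticAt ℂ Ω p.1)
    (hH : AnalyticAt ℂ H p.2) :
    (fun q => (gsPotential δ Ω H q : ℂ)) =ᶠ[𝓝 p] potentialFormula δ Ω H := by
  filter_upwards [modelDomain_mem_nhds hp,
    continuousAt_fst.eventually hΩ.eventually_analyticAt,
    continuousAt_snd.eventually hH.eventually_analyticAt] with q h1 h2 h3
  exact gsPotential_eq hδ h1 h2.differentiableAt h3.differentiableAt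

/-- Symmetry of the Hessian needs `V` to be `C²`. This is read off from the closed form, which
agrees with `V` on a neighbourhood. -/
lemma contDiffAt_gsPotential (hδ : 0 < δ) (hp : p ∈ modelDomain δ) (hΩ : AnalyticAt ℂ Ω p.1)
    (hH : AnalyticAt ℂ H p.2) : ContDiffAt ℝ 2 (gsPotential δ Ω H) p := by
  have hY0 : (gsY δ p : ℂ) ≠ 0 := by exact_mod_cast hp.2.ne'
  have hQ0 : (3 * gsY δ p + δ : ℂ) ≠ 0 := by
    have := hp.2
    exact_mod_cast (by positivity : (3 * gsY δ p + δ : ℝ) ≠ 0)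
  have c1 : ∀ {f : ℂ → ℂ}, AnalyticAt ℂ f p.1 → ContDiffAt ℝ 2 (fun q : ℂ × ℂ => f q.1) p :=
    fun h => (h.contDiffAt.restrict_scalars ℝ).comp p contDiffAt_fst
  have c2 : ∀ {f : ℂ → ℂ}, AnalyticAt ℂ f p.2 → ContDiffAt ℝ 2 (fun q : ℂ × ℂ => f q.2) p :=
    fun h => (h.contDiffAt.restrict_scalars ℝ).comp p contDiffAt_snd
  have cc : ∀ {f : ℂ × ℂ → ℂ}, ContDiffAt ℝ 2 f p → ContDiffAt ℝ 2 (fun q => conj (f q)) p :=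
    fun h => Complex.conjCLE.contDiff.contDiffAt.comp p h
  have hY : ContDiffAt ℝ 2 (fun q => (gsY δ q : ℂ)) p :=
    Complex.ofRealCLM.contDiff.contDiffAt.comp p (contDiffAt_gsY δ hp.1)
  have hT : ContDiffAt ℝ 2 (fun q : ℂ × ℂ => q.2 - conj q.2) p :=
    contDiffAt_snd.sub (cc contDiffAt_snd)
  have hi : ContDiffAt ℝ 2 (fun q : ℂ × ℂ => imTwo q.2) p := contDiffAt_const.mul hT
  have hη6 := (c2 ((analyticAt_eta hp.1).pow 6)).inv (pow_ne_zero 6 (eta_ne_zero hp.1))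
  have hL : ContDiffAt ℝ 2 (fun q : ℂ × ℂ => etaDlog q.2) p := by
    simp only [etaDlog, one_div]
    exact (hT.inv (sub_conj_ne_zero hp.1)).add
      ((contDiffAt_const (c := (2 : ℂ))).mul (c2 (analyticAt_logDeriv_eta hp.1)))
  have i0 := imTwo_ne_zero hp.1
  have hA := (hY.mul (c1 hΩ.deriv)).sub (c1 hΩ)
  have hB := ((c1 hΩ).mul (c2 hH.deriv)).sub
    (((contDiffAt_const (c := (3 : ℂ))).mul (c1 hΩ) |>.add
      ((contDiffAt_const (c := (δ : ℂ))).mul (c1 hΩ.deriv))).mul (hL.mul (c2 hH)))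
  have hHH := (c2 hH).mul (cc (c2 hH))
  have hform : ContDiffAt ℝ 2 (potentialFormula δ Ω H) p :=
    (((hY.inv hY0).mul (((hi.mul hi).mul hi).inv (mul_ne_zero (mul_ne_zero i0 i0) i0))).mul
      (hη6.mul (cc hη6))).mul
    (((hHH.mul (hA.mul (cc hA))).add
      (((hi.mul hi).mul (hY.mul (((contDiffAt_const.mul hY).add contDiffAt_const).inv hQ0))).mul
        (hB.mul (cc hB)))).sub ((contDiffAt_const.mul ((c1 hΩ).mul (cc (c1 hΩ)))).mul hHH))
  have h2 := Complex.reCLM.contDiff.contDiffAt.comp p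
    (hform.congr_of_eventuallyEq (gsPotential_eventuallyEq hδ hp hΩ hH))
  simpa [Function.comp_def] using h2

/-! ### Modular functions at the elliptic points -/

lemma rho_eq : rho = -1 / 2 + (Real.sqrt 3 / 2 : ℝ) * Complex.I := by
  have h : (2 * Real.pi * Complex.I / 3 : ℂ) = ((Real.pi - Real.pi / 3 : ℝ) : ℂ) * Complex.I := by
    push_cast; ring
  rw [rho, h, Complex.exp_mul_I, ← Complex.ofReal_cos, ← Complex.ofReal_sin, Real.cos_pi_sub,
    Real.sin_pi_sub, Real.cos_pi_div_three, Real.sin_pi_div_three]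
  push_cast
  ring

lemma rho_im : rho.im = Real.sqrt 3 / 2 := by
  rw [rho_eq]; simp

lemma rho_im_pos : 0 < rho.im := by
  rw [rho_im]; positivity

lemma rho_sq : rho ^ 2 + rho + 1 = 0 := by
  have h3 : ((Real.sqrt 3 : ℝ) : ℂ) ^ 2 = 3 := by
    exact_mod_cast Real.sq_sqrt (by norm_num : (0 : ℝ) ≤ 3)
  rw [rho_eq]
  push_cast
  linear_combination (1 / 4 : ℂ) * Complex.I ^ 2 * h3 + (3 / 4 : ℂ) * Complex.I_sq

lemma rho_add_one_ne_zero : rho + 1 ≠ 0 := by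
  intro h
  have h1 := rho_sq
  have : rho = -1 := by linear_combination h
  rw [this] at h1
  norm_num at h1

lemma conj_rho : conj rho = -1 - rho := by
  rw [rho_eq]
  simp [-Complex.ofReal_div, Complex.ofReal_div, map_ofNat]
  ring

lemma coe_S_smul (τ : UpperHalfPlane) :
    ((ModularGroup.S • τ : UpperHalfPlane) : ℂ) = -1 / τ := by
  rw [UpperHalfPlane.modular_S_smul]
  simp [neg_div]

lemma coe_ST_smul (τ : UpperHalfPlane) :
    (((ModularGroup.S * ModularGroup.T) • τ : UpperHalfPlane) : ℂ) = -1 / (τ + 1) := by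
  rw [mul_smul, UpperHalfPlane.modular_S_smul, UpperHalfPlane.modular_T_smul]
  rw [neg_div, one_div, ← inv_neg]
  simp [add_comm]

/-- At a point `T₀` fixed by `γ` with `γ'(T₀) ≠ 1`, a function invariant under `γ` up to a constant
cannot have both a nonzero value and a nonzero derivative. -/
lemma eq_zero_or_deriv_eq_zero {H γ : ℂ → ℂ} {T₀ c m : ℂ} (hH : DifferentiableAt ℂ H T₀)
    (hγ : HasDerivAt γ m T₀) (hfix : γ T₀ = T₀) (hm : m ≠ 1)
    (hinv : ∀ᶠ T in 𝓝 T₀, H (γ T) = c * H T) : H T₀ = 0 ∨ deriv H T₀ = 0 := by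
  have h1 : HasDerivAt (fun T => H (γ T)) (deriv H T₀ * m) T₀ := by
    refine HasDerivAt.comp T₀ (h₂ := H) ?_ hγ
    rw [hfix]
    exact hH.hasDerivAt
  have h2 := (hH.hasDerivAt.const_mul c).congr_of_eventuallyEq hinv
  have h3 := h1.unique h2
  have h4 := hinv.self_of_nhds
  rw [hfix] at h4
  -- A nonzero value forces `c = 1`; a nonzero derivative then forces `m = 1`.
  by_contra! h
  have hc : c = 1 := by
    refine mul_right_cancel₀ h.1 ?_
    rw [← h4, one_mul]
  rw [hc, one_mul] at h3
  exact hm (mul_left_cancel₀ h.2 (by rw [h3, mul_one]))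

lemma IsModularUpToPhase.eq_zero_or_deriv_eq_zero {H : ℂ → ℂ} (hH : IsModularUpToPhase H) {T₀ : ℂ}
    (hT₀ : T₀ = Complex.I ∨ T₀ = rho) (hH₀ : AnalyticAt ℂ H T₀) : H T₀ = 0 ∨ deriv H T₀ = 0 := by
  obtain ⟨χ, hχ⟩ := hH.exists_multiplier
  rcases hT₀ with rfl | rfl
  · have hd := (hasDerivAt_inv Complex.I_ne_zero).neg
    refine Heterotic.eq_zero_or_deriv_eq_zero (γ := fun T => -T⁻¹) (c := χ ModularGroup.S)
      hH₀.differentiableAt hd (by simp) (by norm_num) ?_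
    filter_upwards [UpperHalfPlane.isOpen_upperHalfPlaneSet.mem_nhds
      (show 0 < Complex.I.im by simp)] with T hT
    have h := hχ ModularGroup.S ⟨T, hT⟩
    rw [coe_S_smul] at h
    rw [← h]
    congr 1
    simp [neg_div]
  · have h0 := rho_add_one_ne_zero
    have hd := (((hasDerivAt_id rho).add_const 1).inv h0).neg
    refine Heterotic.eq_zero_or_deriv_eq_zero (γ := fun T => -(T + 1)⁻¹)
      (c := χ (ModularGroup.S * ModularGroup.T)) hH₀.differentiableAt hd ?_ ?_ ?_
    · rw [neg_eq_iff_eq_neg]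
      refine inv_eq_of_mul_eq_one_right ?_
      linear_combination -rho_sq
    · intro h
      simp only [id] at h
      field_simp at h
      -- `(ρ + 1)² = ρ` because `ρ² + ρ + 1 = 0`, so a derivative equal to 1 would mean `ρ = 1`.
      have h2 : rho = 1 := by linear_combination -h - rho_sq
      have h1 := rho_sq
      rw [h2] at h1
      norm_num at h1
    · filter_upwards [UpperHalfPlane.isOpen_upperHalfPlaneSet.mem_nhds rho_im_pos] with T hT
      have h := hχ (ModularGroup.S * ModularGroup.T) ⟨T, hT⟩
      rw [coe_ST_smul] at h
      rw [← h]
      congr 1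
      simp [neg_div]

/-! ### Vanishing of `etaDlog` at the elliptic points, through `E₂`. -/

lemma etaDlog_eq (τ : UpperHalfPlane) : etaDlog τ =
    1 / (τ - conj (τ : ℂ)) + Real.pi * Complex.I / 6 * EisensteinSeries.E2 τ := by
  rw [etaDlog, ModularForm.logDeriv_eta_eq_E2]
  ring

/-- The quasi-modular transformation law of `E₂` at a fixed point. -/
lemma E2_fixed (γ : SL(2, ℤ)) {τ : UpperHalfPlane} (h : γ • τ = τ) :
    EisensteinSeries.E2 τ * ((UpperHalfPlane.denom γ τ) ^ 2)⁻¹ = EisensteinSeries.E2 τ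
      - 6 * Complex.I * γ 1 0 / (Real.pi * UpperHalfPlane.denom γ τ) := by
  have hE := congrFun (EisensteinSeries.E2_slash_action γ) τ
  have hd := UpperHalfPlane.denom_ne_zero γ τ
  have hpi : (Real.pi : ℂ) ≠ 0 := by exact_mod_cast Real.pi_ne_zero
  rw [ModularForm.SL_slash_apply, h] at hE
  simp only [riemannZeta_two, Pi.sub_apply, Pi.smul_apply, EisensteinSeries.D2, smul_eq_mul] at hE
  rw [zpow_neg] at hE
  norm_cast at hE ⊢
  rw [hE]
  push_cast
  field_simp

/-- At a fixed point the quasi-modular law is a linear equation for `E₂`. Its solution, `3/π` at `i`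
and `6i/(π(1 + 2ρ))` at `ρ`, cancels `1/(T − T̄)`. -/
lemma etaDlog_elliptic {T₀ : ℂ} (hT₀ : T₀ = Complex.I ∨ T₀ = rho) : etaDlog T₀ = 0 := by
  have hpi : (Real.pi : ℂ) ≠ 0 := by exact_mod_cast Real.pi_ne_zero
  have hI := Complex.I_ne_zero
  rcases hT₀ with rfl | rfl
  · have h := E2_fixed ModularGroup.S (τ := UpperHalfPlane.I) (by
      ext; rw [coe_S_smul]; simp)
    have h2 := etaDlog_eq UpperHalfPlane.I
    rw [ModularGroup.denom_apply] at h
    simp [ModularGroup.S] at h h2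
    rw [h2]
    have h3 : EisensteinSeries.E2 UpperHalfPlane.I * Real.pi = 3 := by
      field_simp at h
      linear_combination (-1 / 2 : ℂ) * h
    rw [← two_mul]
    field_simp
    linear_combination 2 * Complex.I ^ 2 * h3 + 6 * Complex.I_sq
  · have h := E2_fixed (ModularGroup.S * ModularGroup.T) (τ := ⟨rho, rho_im_pos⟩) (by
      ext
      rw [coe_ST_smul, div_eq_iff rho_add_one_ne_zero]
      linear_combination -rho_sq)
    have h2 := etaDlog_eq ⟨rho, rho_im_pos⟩
    have e10 : (ModularGroup.S * ModularGroup.T) 1 0 = 1 := by decide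
    have e11 : (ModularGroup.S * ModularGroup.T) 1 1 = 1 := by decide
    have h1 := rho_add_one_ne_zero
    have hs := rho_sq
    have h12 : 1 + 2 * rho ≠ 0 := by
      intro h0
      have : rho = -1 / 2 := by linear_combination h0 / 2
      rw [this] at hs
      norm_num at hs
    rw [ModularGroup.denom_apply, e10, e11] at h
    simp only [conj_rho, Int.cast_one, one_mul, mul_one] at h h2
    rw [h2, show rho - (-1 - rho) = 1 + 2 * rho by ring]
    generalize EisensteinSeries.E2 ⟨rho, rho_im_pos⟩ = E at h ⊢
    field_simp at h
    have hX : E * Real.pi * (1 + 2 * rho) = 6 * Complex.I := by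
      linear_combination rho * h + (E * Real.pi * (rho + 1) - 6 * Complex.I) * hs
    rw [div_add' _ _ _ h12, div_eq_zero_iff]
    left
    linear_combination Complex.I / 6 * hX + Complex.I_sq

/-! ### The two unstable directions -/

lemma potential_slice_eventuallyEq (hδ : 0 < δ) (hp : p ∈ modelDomain δ)
    (hΩ : AnalyticAt ℂ Ω p.1) (hH : AnalyticAt ℂ H p.2) (a : Fin 2) :
    (fun w => (gsPotential δ Ω H (slice a p w) : ℂ)) =ᶠ[𝓝 (field a p)]
      fun w => potentialFormula δ Ω H (slice a p w) :=
  eventually_slice (gsPotential_eventuallyEq hδ hp hΩ hH)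

lemma hasWirtingerJet_gsY_zero (δ : ℝ) (p : ℂ × ℂ) :
    HasWirtingerJet (fun w => (gsY δ (w, p.2) : ℂ)) 1 1 0 p.1 :=
  ⟨fun _ => 1, fun _ => 1, .of_forall fun w => hasWirtingerAt_gsY_zero δ p w, rfl, rfl,
    ⟨0, .const _ _⟩, ⟨0, .const _ _⟩⟩

lemma hasWirtingerJet_sub_conj (z : ℂ) : HasWirtingerJet (fun w => w - conj w) 1 (-1) 0 z := by
  simpa using (HasWirtingerJet.id z).sub (HasWirtingerJet.id z).star

lemma hasWirtingerJet_imTwo (z : ℂ) : HasWirtingerJet imTwo (-Complex.I) Complex.I 0 z :=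
  ((hasWirtingerJet_sub_conj z).const_mul (-Complex.I)).of_eq (by ring) (by ring) (by ring)

lemma sub_conj_sq (T : ℂ) : (T - conj T) ^ 2 = -imTwo T ^ 2 := by
  rw [imTwo, mul_pow, neg_sq, Complex.I_sq]
  ring

/-- Only `∂̄L` must be explicit: when `L = H = 0`, the mixed derivative of `L H` is `∂̄L · H'`,
while `α` and `γ` are multiplied by `H`. -/
lemma hasWirtingerJet_etaDlog {T : ℂ} (hT : 0 < T.im) :
    ∃ α γ, HasWirtingerJet etaDlog α (-1 / imTwo T ^ 2) γ T := by
  have h1 := (hasWirtingerJet_sub_conj T).inv (sub_conj_ne_zero hT)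
  have h2 := HasWirtingerJet.of_analyticAt (analyticAt_logDeriv_eta hT)
  refine ⟨_, _, ((h1.add (h2.const_mul 2)).congr (.of_forall fun w => ?_)).of_eq rfl ?_ rfl⟩
  · simp only [etaDlog, one_div]
  · rw [sub_conj_sq]
    simp [div_neg, neg_div]

lemma hasWirtingerJet_gsY_one (δ : ℝ) {p : ℂ × ℂ} (hp : 0 < p.2.im) :
    HasWirtingerJet (fun w => (gsY δ (p.1, w) : ℂ)) (δ * etaDlog p.2) (δ * conj (etaDlog p.2))
      (-δ / imTwo p.2 ^ 2) p.2 := by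
  obtain ⟨α, γ, h⟩ := hasWirtingerJet_etaDlog hp
  have hL := h.hasWirtingerAt
  refine ⟨fun w => δ * etaDlog w, fun w => δ * conj (etaDlog w), ?_, rfl, rfl,
    ⟨_, (hL.const_mul δ).of_eq rfl (by ring)⟩, ⟨_, (hL.star.const_mul δ).of_eq ?_ rfl⟩⟩
  · filter_upwards [UpperHalfPlane.isOpen_upperHalfPlaneSet.mem_nhds hp] with w hw
    exact hasWirtingerAt_gsY_one δ p hw
  · rw [imTwo_eq]
    simp only [map_div₀, map_neg, map_one, map_pow, Complex.conj_ofReal]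
    ring

/-- The positive factor of the potential which depends only on the modulus. -/
def modulusFactor (T : ℂ) : ℝ :=
  ((2 * T.im) ^ 3)⁻¹ * Complex.normSq (ModularForm.eta T ^ 6)⁻¹

lemma modulusFactor_pos {T : ℂ} (hT : 0 < T.im) : 0 < modulusFactor T :=
  mul_pos (by positivity) (Complex.normSq_pos.2 (inv_ne_zero (pow_ne_zero 6 (eta_ne_zero hT))))

lemma modulusFactor_eq (T : ℂ) : (modulusFactor T : ℂ) =
    (imTwo T * imTwo T * imTwo T)⁻¹ *
      ((ModularForm.eta T ^ 6)⁻¹ * conj (ModularForm.eta T ^ 6)⁻¹) := by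
  rw [modulusFactor, Complex.mul_conj, imTwo_eq]
  push_cast
  ring

/-- Conjugates are treated as independent variables. Stationarity reduces to `Y² Ω'' Ā = 2 A Ω̄`;
this, its conjugate and their product eliminate the second derivatives of `Ω`. -/
lemma dilaton_algebra {Y o o₁ o₂ ob ob₁ ob₂ A Ab n nb N : ℂ} (hA : A ≠ 0)
    (hAb : Ab ≠ 0) (hAo : A = Y * o₁ - o) (hAob : Ab = Y * ob₁ - ob)
    (hN : N = A * Ab - 3 * (o * ob))
    (hn : n = Y * o₂ * Ab + A * ob₁ - 3 * (o₁ * ob))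
    (hnb : nb = Y * ob₂ * A + Ab * o₁ - 3 * (ob₁ * o))
    (hc : Y * n = N) (hcb : Y * nb = N) :
    Y ^ 2 * (o₂ * Ab + Y * o₂ * (Y * ob₂) + o₁ * ob₁ + A * ob₂ - 3 * (o₁ * ob₁)) =
      2 * (o * ob) - 2 * (A * Ab) := by
  have h1 : Y ^ 2 * o₂ * Ab = 2 * A * ob := by
    linear_combination hc - Y * hn + hN + (-3 * ob) * hAo + A * hAob
  have h2 : Y ^ 2 * ob₂ * A = 2 * Ab * o := by
    linear_combination hcb - Y * hnb + hN + (-3 * o) * hAob + Ab * hAo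
  have h3 : Y ^ 2 * o₂ * (Y ^ 2 * ob₂) = 4 * (o * ob) := by
    refine mul_right_cancel₀ (mul_ne_zero hA hAb) ?_
    linear_combination (Y ^ 2 * ob₂ * A) * h1 + (2 * A * ob) * h2
  have e1 : Y * o₁ = A + o := by rw [hAo]; ring
  have e2 : Y * ob₁ = Ab + ob := by rw [hAob]; ring
  linear_combination h1 + h2 + h3 - 2 * (Y * ob₁) * e1 - 2 * (A + o) * e2

/-- If `∂_T H = 0` at an elliptic point, then `∂_S ∂_S̄ V < 0` at a point of positive energy that is
critical in the dilaton direction. -/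
lemma dz_dzbar_dilaton_neg (hδ : 0 < δ) (hp : p ∈ modelDomain δ) (hΩ : AnalyticAt ℂ Ω p.1)
    (hH : AnalyticAt ℂ H p.2) (hL : etaDlog p.2 = 0) (hH' : deriv H p.2 = 0)
    (hV : 0 < gsPotential δ Ω H p) (hcrit : dz 0 (fun q => (gsPotential δ Ω H q : ℂ)) p = 0) :
    ∃ r : ℝ, r < 0 ∧ dz 0 (dzbar 0 fun q => (gsPotential δ Ω H q : ℂ)) p = r := by
  have hYpos := hp.2
  have hY0 : (gsY δ p : ℂ) ≠ 0 := by exact_mod_cast hp.2.ne'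
  set c : ℝ := modulusFactor p.2 * Complex.normSq (H p.2) with hc
  set Y : ℝ := gsY δ p with hYdef
  set o := Ω p.1 with ho
  set o₁ := deriv Ω p.1 with ho₁
  set A := Y * o₁ - o with hA
  -- Only `S` is varied, so `L = H' = 0` may be inserted before differentiating.
  have hform : ∀ w, potentialFormula δ Ω H (w, p.2) = c * ((gsY δ (w, p.2) : ℂ)⁻¹ *
      ((gsY δ (w, p.2) * deriv Ω w - Ω w) * conj (gsY δ (w, p.2) * deriv Ω w - Ω w) -
        3 * (Ω w * conj (Ω w)))) := by
    intro w
    rw [hc, Complex.ofReal_mul, modulusFactor_eq, ← Complex.mul_conj, potentialFormula]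
    simp only [hL, hH', zero_mul, mul_zero, sub_zero, map_zero, add_zero]
    ring
  have hval : gsPotential δ Ω H p = c * (Y⁻¹ * (Complex.normSq A - 3 * Complex.normSq o)) := by
    have h := (gsPotential_eventuallyEq hδ hp hΩ hH).self_of_nhds
    have h2 := hform p.1
    simp only [Prod.mk.eta] at h2
    rw [h2, ← hYdef, ← ho₁, ← ho, ← hA, Complex.mul_conj, Complex.mul_conj] at h
    beta_reduce at h
    exact_mod_cast h
  have hc0 : 0 ≤ c := mul_nonneg (modulusFactor_pos hp.1).le (Complex.normSq_nonneg _)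
  have hcpos : 0 < c := by
    refine lt_of_le_of_ne hc0 fun h => ?_
    rw [hval, ← h, zero_mul] at hV
    exact lt_irrefl _ hV
  have hN : 3 * Complex.normSq o < Complex.normSq A := by
    rw [hval] at hV
    have := pos_of_mul_pos_right (pos_of_mul_pos_right hV hc0) (by positivity)
    linarith
  have hA0 : A ≠ 0 := by
    intro h
    rw [h, map_zero] at hN
    linarith [Complex.normSq_nonneg o]
  have hAb0 : conj A ≠ 0 := by simpa using hA0
  have jY := hasWirtingerJet_gsY_zero δ p
  have jΩ := HasWirtingerJet.of_analyticAt hΩ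
  have jΩ' := HasWirtingerJet.of_analyticAt hΩ.deriv
  set o₂ := deriv (deriv Ω) p.1 with ho₂
  have jA : HasWirtingerJet (fun w => gsY δ (w, p.2) * deriv Ω w - Ω w) (Y * o₂) o₁ o₂ p.1 :=
    ((jY.mul jΩ').sub jΩ).of_eq (by simp [o₂, Y]) (by simp [o₁]) (by simp [o₂])
  have jN := (jA.mul jA.star).sub ((jΩ.mul jΩ.star).const_mul 3)
  have jV := ((jY.inv hY0).mul jN).const_mul (c : ℂ)
  have jV' := (jV.congr (.of_forall hform)).congr (potential_slice_eventuallyEq hδ hp hΩ hH 0)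
  have hc1 := (dz_eq (f := fun q => (gsPotential δ Ω H q : ℂ)) (a := 0) (p := p)
    jV'.hasWirtingerAt).symm.trans hcrit
  have hc2 : (c : ℂ) ≠ 0 := by exact_mod_cast hcpos.ne'
  have hres := dz_dzbar_eq (f := fun q => (gsPotential δ Ω H q : ℂ)) (a := 0) (p := p) jV'
  simp only [Prod.mk.eta, ← hYdef, ← ho, ← ho₁, ← hA] at hc1 hres
  have key : (Y : ℂ) * (Y * o₂ * conj A + A * conj o₁ - 3 * (o₁ * conj o)) =
      A * conj A - 3 * (o * conj o) := by
    have h := (mul_eq_zero.1 hc1).resolve_left hc2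
    field_simp at h
    simp only [map_zero] at h
    linear_combination h
  have keyb := congrArg conj key
  simp only [map_mul, map_add, map_sub, Complex.conj_ofReal, Complex.conj_conj, map_ofNat] at keyb
  have alg := dilaton_algebra (Y := Y) (o := o) (o₁ := o₁) (o₂ := o₂) (ob := conj o)
    (ob₁ := conj o₁) (ob₂ := conj o₂) hA0 hAb0 hA (by simp [hA]) rfl rfl rfl key
    (by rw [keyb]; ring)
  refine ⟨c * (Y ^ 3)⁻¹ * (2 * Complex.normSq o - 2 * Complex.normSq A), ?_, ?_⟩
  · refine mul_neg_of_pos_of_neg (by positivity) ?_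
    linarith [Complex.normSq_nonneg o]
  · rw [hres]
    push_cast
    rw [← Complex.mul_conj, ← Complex.mul_conj]
    simp only [map_zero, map_mul, Complex.conj_ofReal]
    field_simp
    -- With `N = |A|² − 3|Ω|²`, `∂∂̄(N/Y) = ∂∂̄N/Y − (∂N + ∂̄N)/Y² + 2N/Y³`; stationarity, `Y ∂N = N
    -- = Y ∂̄N`, cancels the last two terms.
    linear_combination alg - key - keyb

lemma deriv_eta_inv_pow {T : ℂ} (hT : 0 < T.im) (hL : etaDlog T = 0) :
    deriv (ModularForm.eta ^ 6)⁻¹ T =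
      -3 * Complex.I / imTwo T * (ModularForm.eta T ^ 6)⁻¹ := by
  have hη0 := eta_ne_zero hT
  have h0 := sub_conj_ne_zero hT
  have h1 : logDeriv ModularForm.eta T = -1 / (2 * (T - conj T)) := by
    rw [etaDlog] at hL
    field_simp
    field_simp at hL
    linear_combination hL
  rw [logDeriv_apply, div_eq_iff hη0] at h1
  rw [((((analyticAt_eta hT).differentiableAt.hasDerivAt).pow 6).inv (pow_ne_zero 6 hη0)).deriv,
    h1, imTwo]
  have hI := Complex.I_ne_zero
  simp
  field_simp
  ring

/-- The prefactor is `Y⁻¹ (y |η|⁴)⁻³`, so its first derivatives are multiples of `L` or `L̄` and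
vanish. The mixed one survives through `∂∂̄ ln(y |η|⁴) = −1/y²`. -/
lemma hasWirtingerJet_prefactor (hp : p ∈ modelDomain δ) (hL : etaDlog p.2 = 0) :
    HasWirtingerJet (fun w => (gsY δ (p.1, w) : ℂ)⁻¹ * (imTwo w * imTwo w * imTwo w)⁻¹
        * ((ModularForm.eta w ^ 6)⁻¹ * conj (ModularForm.eta w ^ 6)⁻¹)) 0 0
      ((gsY δ p : ℂ)⁻¹ * modulusFactor p.2 * ((3 * gsY δ p + δ) / (gsY δ p * imTwo p.2 ^ 2)))
      p.2 := by
  have hY0 : (gsY δ p : ℂ) ≠ 0 := by exact_mod_cast hp.2.ne'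
  have hi0 := imTwo_ne_zero hp.1
  have hη0 := eta_ne_zero hp.1
  have jY := hasWirtingerJet_gsY_one δ hp.1
  have ji := hasWirtingerJet_imTwo p.2
  have jk := HasWirtingerJet.of_analyticAt
    (((analyticAt_eta hp.1).pow 6).inv (pow_ne_zero 6 hη0))
  have hk : deriv (ModularForm.eta ^ 6)⁻¹ p.2 =
      -3 * Complex.I / imTwo p.2 * (ModularForm.eta p.2 ^ 6)⁻¹ := deriv_eta_inv_pow hp.1 hL
  have hib : conj (imTwo p.2) = imTwo p.2 := by rw [imTwo_eq, Complex.conj_ofReal]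
  have jg := ((jY.inv hY0).mul (((ji.mul ji).mul ji).inv
    (mul_ne_zero (mul_ne_zero hi0 hi0) hi0))).mul (jk.mul jk.star)
  rw [modulusFactor_eq]
  refine jg.of_eq ?_ ?_ ?_ <;>
  · simp only [hk, hL, map_mul, map_div₀, map_neg, hib, Complex.conj_I, map_ofNat, Prod.mk.eta,
      map_zero, Pi.inv_apply, Pi.pow_apply]
    generalize (ModularForm.eta p.2 ^ 6)⁻¹ = k
    generalize imTwo p.2 = y at *
    generalize (gsY δ p : ℂ) = Y at *
    field_simp
    ring_nf
    try simp only [Complex.I_sq]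
    try ring

/-- At a zero of `H` at an elliptic point, stationarity in the dilaton fixes `∂_S Ω`. -/
lemma deriv_eq_of_critical_dilaton (hδ : 0 < δ) (hp : p ∈ modelDomain δ) (hΩ : AnalyticAt ℂ Ω p.1)
    (hH : AnalyticAt ℂ H p.2) (hH0 : H p.2 = 0) (hH' : deriv H p.2 ≠ 0) (hΩ0 : Ω p.1 ≠ 0)
    (hcrit : dz 0 (fun q => (gsPotential δ Ω H q : ℂ)) p = 0) :
    (3 * gsY δ p + δ) * deriv Ω p.1 = 3 * Ω p.1 := by
  have hYpos := hp.2
  have hY0 : (gsY δ p : ℂ) ≠ 0 := by exact_mod_cast hp.2.ne'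
  have hQ0 : (3 * gsY δ p + δ : ℂ) ≠ 0 := by
    exact_mod_cast (by positivity : (3 * gsY δ p + δ : ℝ) ≠ 0)
  have hi0 := imTwo_ne_zero hp.1
  set k : ℂ := modulusFactor p.2 * (imTwo p.2 * imTwo p.2) * (deriv H p.2 * conj (deriv H p.2))
    with hk
  have hk0 : k ≠ 0 := by
    have : (modulusFactor p.2 : ℂ) ≠ 0 := by exact_mod_cast (modulusFactor_pos hp.1).ne'
    have h2 : conj (deriv H p.2) ≠ 0 := by simpa using hH'
    exact mul_ne_zero (mul_ne_zero this (mul_ne_zero hi0 hi0)) (mul_ne_zero hH' h2)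
  have hform : ∀ w, potentialFormula δ Ω H (w, p.2) = k * ((gsY δ (w, p.2) : ℂ)⁻¹ *
      (gsY δ (w, p.2) * (3 * gsY δ (w, p.2) + δ : ℂ)⁻¹) * (Ω w * conj (Ω w))) := by
    intro w
    rw [hk, modulusFactor_eq, potentialFormula]
    simp only [hH0, zero_mul, mul_zero, sub_zero, map_mul, zero_add]
    ring
  have jY := hasWirtingerJet_gsY_zero δ p
  have jΩ := HasWirtingerJet.of_analyticAt hΩ
  have jV := (((jY.inv hY0).mul (jY.mul
    (((jY.const_mul 3).add (HasWirtingerJet.const (δ : ℂ) _)).inv hQ0))).mul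
      (jΩ.mul jΩ.star)).const_mul k
  have jV' := (jV.congr (.of_forall hform)).congr (potential_slice_eventuallyEq hδ hp hΩ hH 0)
  have h := (dz_eq (f := fun q => (gsPotential δ Ω H q : ℂ)) (a := 0) (p := p)
    jV'.hasWirtingerAt).symm.trans hcrit
  have h2 := (mul_eq_zero.1 h).resolve_left hk0
  simp only [Prod.mk.eta, map_zero] at h2
  have hob : conj (Ω p.1) ≠ 0 := by simpa using hΩ0
  generalize hQ : (3 * gsY δ p + δ : ℂ) = Q at *
  field_simp at h2
  refine mul_right_cancel₀ (mul_ne_zero hY0 hob) ?_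
  linear_combination h2

/-- If `H` vanishes at an elliptic point, then `∂_T ∂_T̄ V < 0` at a critical point of positive
energy. -/
lemma dz_dzbar_modulus_neg (hδ : 0 < δ) (hp : p ∈ modelDomain δ) (hΩ : AnalyticAt ℂ Ω p.1)
    (hH : AnalyticAt ℂ H p.2) (hL : etaDlog p.2 = 0) (hH0 : H p.2 = 0)
    (hV : 0 < gsPotential δ Ω H p) (hcrit : IsCritical (gsPotential δ Ω H) p) :
    ∃ r : ℝ, r < 0 ∧ dz 1 (dzbar 1 fun q => (gsPotential δ Ω H q : ℂ)) p = r := by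
  have hYpos := hp.2
  have hY0 : (gsY δ p : ℂ) ≠ 0 := by exact_mod_cast hp.2.ne'
  have hQ0 : (3 * gsY δ p + δ : ℂ) ≠ 0 := by
    exact_mod_cast (by positivity : (3 * gsY δ p + δ : ℝ) ≠ 0)
  have hi0 := imTwo_ne_zero hp.1
  have hv := (gsPotential_eventuallyEq hδ hp hΩ hH).self_of_nhds
  -- With `H = 0` the potential is proportional to `|Ω H'|²`, so `V > 0` makes both factors nonzero.
  have hne : Ω p.1 ≠ 0 ∧ deriv H p.2 ≠ 0 := by
    rw [← not_or]
    intro h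
    have h0 : potentialFormula δ Ω H p = 0 := by
      rcases h with h | h <;> simp [potentialFormula, hH0, h]
    beta_reduce at hv
    rw [h0] at hv
    exact hV.ne' (by exact_mod_cast hv)
  have hS := deriv_eq_of_critical_dilaton hδ hp hΩ hH hH0 hne.2 hne.1 (hcrit 0)
  obtain ⟨α, γ, jL⟩ := hasWirtingerJet_etaDlog hp.1
  have jY := hasWirtingerJet_gsY_one δ hp.1
  have ji := hasWirtingerJet_imTwo p.2
  have jH := HasWirtingerJet.of_analyticAt hH
  have jH' := HasWirtingerJet.of_analyticAt hH.deriv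
  have jg := hasWirtingerJet_prefactor hp hL
  have jc := fun c => HasWirtingerJet.const c p.2
  have hob : conj (Ω p.1) ≠ 0 := by simpa using hne.1
  have hhb : conj (deriv H p.2) ≠ 0 := by simpa using hne.2
  have hib : conj (imTwo p.2) = imTwo p.2 := by rw [imTwo_eq, Complex.conj_ofReal]
  have jA := (jY.mul (jc (deriv Ω p.1))).sub (jc (Ω p.1))
  have jB := (jH'.const_mul (Ω p.1)).sub
    ((jL.mul jH).const_mul (3 * Ω p.1 + δ * deriv Ω p.1))
  have jM := (((jH.mul jH.star).mul (jA.mul jA.star)).add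
    (((ji.mul ji).mul (jY.mul (((jY.const_mul 3).add (jc δ)).inv hQ0))).mul
      (jB.mul jB.star))).sub ((jc (3 * (Ω p.1 * conj (Ω p.1)))).mul (jH.mul jH.star))
  have jV := (jg.mul jM).congr (g := fun w => potentialFormula δ Ω H (slice 1 p w))
    (.of_forall fun w => by simp only [potentialFormula, slice_one])
  have jV' := jV.congr (potential_slice_eventuallyEq hδ hp hΩ hH 1)
  have h1 := (dz_eq (f := fun q => (gsPotential δ Ω H q : ℂ)) (a := 1) (p := p)
    jV'.hasWirtingerAt).symm.trans (hcrit 1)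
  have hres := dz_dzbar_eq (f := fun q => (gsPotential δ Ω H q : ℂ)) (a := 1) (p := p) jV'
  have hgf : (gsY δ p : ℂ)⁻¹ * (imTwo p.2 * imTwo p.2 * imTwo p.2)⁻¹
        * ((ModularForm.eta p.2 ^ 6)⁻¹ * conj (ModularForm.eta p.2 ^ 6)⁻¹) =
      (gsY δ p : ℂ)⁻¹ * modulusFactor p.2 := by
    rw [modulusFactor_eq]; ring
  have hm0 : (modulusFactor p.2 : ℂ) ≠ 0 := by exact_mod_cast (modulusFactor_pos hp.1).ne'
  simp only [Prod.mk.eta, hgf, hH0, hL, mul_zero, zero_mul, add_zero, zero_add, sub_zero, map_zero,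
    map_mul, map_sub, map_add, Complex.conj_ofReal, map_div₀, map_neg, map_one, map_pow, hib,
    map_ofNat, zero_div] at h1 hres
  clear jV jV' jM jB jA jg jH' jH ji jY jL jc hv hgf
  -- The prefactor is stationary, `∂_T Y = δL = 0` and the `|H|²` terms drop, so `∂_T V = 0`
  -- balances the derivative of `y²` against `H''`.
  have hH'' : deriv (deriv H) p.2 = 2 * Complex.I / imTwo p.2 * deriv H p.2 := by
    have h2 := (mul_eq_zero.1 h1).resolve_left (mul_ne_zero (inv_ne_zero hY0) hm0)
    have h3 : (imTwo p.2 * (gsY δ p * (3 * gsY δ p + δ : ℂ)⁻¹) *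
        (Ω p.1 * (conj (Ω p.1) * conj (deriv H p.2)))) *
        (imTwo p.2 * deriv (deriv H) p.2 - 2 * Complex.I * deriv H p.2) = 0 := by
      linear_combination h2
    have h4 := (mul_eq_zero.1 h3).resolve_left
      (mul_ne_zero (mul_ne_zero hi0 (mul_ne_zero hY0 (inv_ne_zero hQ0)))
        (mul_ne_zero hne.1 (mul_ne_zero hob hhb)))
    field_simp
    linear_combination h4
  have hΩ' : deriv Ω p.1 = 3 * Ω p.1 / (3 * gsY δ p + δ) := by
    rw [eq_div_iff hQ0, mul_comm, hS]
  -- The value after inserting `Ω'` and `H''`; every coefficient of the quadratic in `Y` and `δ` is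
  -- positive.
  refine ⟨-((gsY δ p)⁻¹ * modulusFactor p.2 * (Complex.normSq (Ω p.1) *
    Complex.normSq (deriv H p.2)) * ((6 * gsY δ p ^ 2 + 2 * gsY δ p * δ + 2 * δ ^ 2) /
      (3 * gsY δ p + δ) ^ 2)), ?_, ?_⟩
  · have h1 := modulusFactor_pos hp.1
    have h2 := Complex.normSq_pos.2 hne.1
    have h3 := Complex.normSq_pos.2 hne.2
    exact neg_neg_of_pos (by positivity)
  · rw [hres, hH'', hΩ']
    push_cast
    rw [← Complex.mul_conj, ← Complex.mul_conj]
    simp only [map_mul, map_div₀, map_add, Complex.conj_ofReal, Complex.conj_I, map_ofNat, hib]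
    clear hres h1 hS hΩ' hH'' hV
    generalize imTwo p.2 = y at *
    generalize (gsY δ p : ℂ) = Y at *
    generalize (δ : ℂ) = d at *
    generalize hQ : 3 * Y + d = Q at *
    obtain rfl : d = Q - 3 * Y := by rw [← hQ]; ring
    field_simp
    ring_nf
    simp only [Complex.I_sq]
    ring

end Heterotic

end

theorem theorem3 (δ : ℝ) (hδ : 0 < δ) (Ω H : ℂ → ℂ) (S₀ T₀ : ℂ)
    (hT₀ : T₀ = Complex.I ∨ T₀ = Heterotic.rho)
    (hΩ : AnalyticAt ℂ Ω S₀)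
    (hH : Heterotic.IsModularUpToPhase H) (hH₀ : AnalyticAt ℂ H T₀)
    (hY : 0 < Heterotic.gsY δ (S₀, T₀)) :
    ¬ Heterotic.IsDeSitterVacuum (Heterotic.gsPotential δ Ω H) (S₀, T₀) ∧
    (0 < Heterotic.gsPotential δ Ω H (S₀, T₀) →
      Heterotic.IsCritical (Heterotic.gsPotential δ Ω H) (S₀, T₀) →
      (H T₀ ≠ 0 → ∃ r : ℝ, r < 0 ∧
        Heterotic.dz 0 (Heterotic.dzbar 0 fun q => (Heterotic.gsPotential δ Ω H q : ℂ)) (S₀, T₀)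
          = r) ∧
      (deriv H T₀ ≠ 0 → ∃ r : ℝ, r < 0 ∧
        Heterotic.dz 1 (Heterotic.dzbar 1 fun q => (Heterotic.gsPotential δ Ω H q : ℂ)) (S₀, T₀)
          = r)) := by
  have him : 0 < T₀.im := by
    rcases hT₀ with rfl | rfl
    · simp
    · exact Heterotic.rho_im_pos
  have hp : ((S₀, T₀) : ℂ × ℂ) ∈ Heterotic.modelDomain δ := ⟨him, hY⟩
  have hL := Heterotic.etaDlog_elliptic hT₀
  have hor := hH.eq_zero_or_deriv_eq_zero hT₀ hH₀
  have hmain : 0 < Heterotic.gsPotential δ Ω H (S₀, T₀) →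
      Heterotic.IsCritical (Heterotic.gsPotential δ Ω H) (S₀, T₀) → _ := fun hV hc =>
    And.intro (fun h : H T₀ ≠ 0 => Heterotic.dz_dzbar_dilaton_neg hδ hp hΩ hH₀ hL
      (hor.resolve_left h) hV (hc 0)) (fun h : deriv H T₀ ≠ 0 =>
        Heterotic.dz_dzbar_modulus_neg hδ hp hΩ hH₀ hL (hor.resolve_right h) hV hc)
  refine ⟨fun hdS => ?_, hmain⟩
  have hC := Heterotic.contDiffAt_gsPotential hδ hp hΩ hH₀
  -- `H T₀ ≠ 0` makes `S` unstable; `H T₀ = 0` makes `T` unstable, with `H' ≠ 0` supplied by `V >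
  -- 0`.
  have hneg : ∃ a : Fin 2, ∃ r : ℝ, r < 0 ∧ Heterotic.dz a
      (Heterotic.dzbar a fun q => (Heterotic.gsPotential δ Ω H q : ℂ)) (S₀, T₀) = r := by
    by_cases h : H T₀ = 0
    · exact ⟨1, Heterotic.dz_dzbar_modulus_neg hδ hp hΩ hH₀ hL h hdS.pos hdS.critical⟩
    · exact ⟨0, (hmain hdS.pos hdS.critical).1 h⟩
  obtain ⟨a, r, hr, h⟩ := hneg
  have := Heterotic.re_dz_dzbar_nonneg hC hdS.eigenvalues_nonneg a
  rw [h, Complex.ofReal_re] at this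
  exact absurd hr this.not_gt
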